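/- Let $\mathbb K$ be $\mathbb R$ or $\mathbb C$ and let $m\ge 2$ be an integer. For $1\le p\le\infty$ and $n\ge 1$ let $\ell_p^n$ be $\mathbb K^n$ with the $\ell_p$-norm and canonical unit vectors $e_1,\dots,e_n$, and for an $m$-linear form $T:\ell_p^n\times\cdots\times\ell_p^n\to\mathbb K$ let $\|T\|$ be the supremum of $|T|$ over the product of the closed unit balls. For $r\in[1,\infty)$, $D>0$ and $s\in\mathbb R$ consider the inequality $$\Big(\sum_{j_1,\dots,j_m=1}^n |T(e_{j_1},\dots,e_{j_m})|^r\Big)^{1/r}\le D\, n^{s}\,\|T\| .\qquad (\ast)$$ (a) Let $(r,p)\in([1,2]\times[2,2m))\cup([1,\infty)\times[2m,\infty])$ and $\alpha=\max\left\{\frac{2mr+2mp-mpr-pr}{2pr},0\right\}$, where for $p=\infty$ the fraction is understood as its limit $\frac{2m-mr-r}{2r}$. Then there is a constant $D>0$, depending only on $m$, $r$, $p$ and $\mathbb K$, such that $(\ast)$ with $s=\alpha$ holds for all $m$-linear forms $T:\ell_p^n\times\cdots\times\ell_p^n\to\mathbb K$ and all positive integers $n$. Moreover, the exponent $\alpha$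 is optimal: if $s\in\mathbb R$ and there is a constant $D>0$ not depending on $n$ such that $(\ast)$ holds for all such $T$ and all positive integers $n$, then $s\ge\alpha$. (b) Let $(r,p)\in[2,\infty)\times(m,2m]$ and $\beta=\max\left\{\frac{p+mr-rp}{pr},0\right\}$. Then $(\ast)$ with $s=\beta$ and $D=(\sqrt2)^{m-1}$ holds for all $m$-linear forms $T:\ell_p^n\times\cdots\times\ell_p^n\to\mathbb K$ and all positive integers $n$. Moreover, the exponent $\beta$ is optimal: if $s\in\mathbb R$ and there is a constant $D>0$ not depending on $n$ such that $(\ast)$ holds for all such $T$ and all positive integers $n$, then $s\ge\beta$. -/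

import Mathlib

open scoped ENNReal

/-- The `n`-dimensional space `ℓ_p^n` over `𝕜`. -/
abbrev ellp (𝕜 : Type*) (p : ℝ≥0∞) (n : ℕ) : Type _ :=
  PiLp p (fun _ : Fin n => 𝕜)

/-- The `j`-th canonical unit vector `e_j` of `ℓ_p^n`. -/
def unitVec (𝕜 : Type*) [RCLike 𝕜] (p : ℝ≥0∞) {n : ℕ} (j : Fin n) : ellp 𝕜 p n :=
  WithLp.toLp p (Pi.single j (1 : 𝕜))

/-- The `ℓ_r`-sum of the coefficients of an `m`-linear form `T` on `ℓ_p^n`: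
`(∑_{j_1, …, j_m = 1}^n |T(e_{j_1}, …, e_{j_m})|^r)^{1/r}`. -/
noncomputable def coeffSum {𝕜 : Type*} [RCLike 𝕜] {m n : ℕ} {p : ℝ≥0∞} [Fact (1 ≤ p)] (r : ℝ)
    (T : ContinuousMultilinearMap 𝕜 (fun _ : Fin m => ellp 𝕜 p n) 𝕜) : ℝ :=
  (∑ j : Fin m → Fin n, ‖T (fun i => unitVec 𝕜 p (j i))‖ ^ r) ^ (1 / r)

/-- The inequality `(∑ |T(e_{j_1}, …, e_{j_m})|^r)^{1/r} ≤ D n^s ‖T‖` for all positive integers `n`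
and all `m`-linear forms `T` on `ℓ_p^n` (they are all continuous, `ℓ_p^n` being finite dimensional);
`‖T‖` is the supremum of `|T|` over the product of the closed unit balls. -/
def HLInequality (𝕜 : Type*) [RCLike 𝕜] (m : ℕ) (r : ℝ) (p : ℝ≥0∞) [Fact (1 ≤ p)]
    (D s : ℝ) : Prop :=
  ∀ n : ℕ, 0 < n → ∀ T : ContinuousMultilinearMap 𝕜 (fun _ : Fin m => ellp 𝕜 p n) 𝕜,
    coeffSum r T ≤ D * (n : ℝ) ^ s * ‖T‖

/-- The number `(2mr + 2mp - mpr - pr) / (2pr)`, understood as its limit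
`(2m - mr - r) / (2r)` when `p = ∞`. -/
noncomputable def expA (m : ℕ) (r : ℝ) (p : ℝ≥0∞) : ℝ :=
  if p = ∞ then (2 * m - m * r - r) / (2 * r)
  else (2 * m * r + 2 * m * p.toReal - m * p.toReal * r - p.toReal * r) / (2 * p.toReal * r)

/-- The number `(p + mr - rp) / (pr)` (used for finite `p` only). -/
noncomputable def expB (m : ℕ) (r : ℝ) (p : ℝ≥0∞) : ℝ :=
  (p.toReal + m * r - r * p.toReal) / (p.toReal * r)

/-!
The unit ball of `ℓ_p^n` is described by domination, `|y i| ≤ (w i) ^ t` with `t = 1 / p` and a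
nonnegative weight `w` of mass at most one, so that `p = ∞` is the case `t = 0` and everything
becomes a statement about coefficient arrays `a` (`FormBound`).

*Upper estimates.* Khinchine's inequality with constant `√2` in all variables but one gives the
mixed `(ℓ₁, ℓ₂)` inequality for forms on `ℓ_∞^n` (`FormBound.sum_sqrt_marginal_le`). The constant
comes from the argument of Latała and Oleszkiewicz: the norm of a Rademacher sum is an even function
on the discrete cube, so it satisfies a Poincaré inequality that is better by a factor two.

For `p ≥ 2m` let `1 / ρ = 1 / 2 + 1 / (2m) - 1 / p` and normalize `∑ |a| ^ ρ = 1`. Then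
`c = |a| ^ ρ` is a probability on multi-indices, and the `1 / p`-th powers of its marginals `X_l`
are unit vectors of `ℓ_p^n`. Multiplying the variables by them turns `a` into a form on `ℓ_∞^n`; the
mixed inequality, the Cauchy–Schwarz inequality and an average over the distinguished variable give
`∑ c (c / ∏ X_l) ^ δ ≤ √2 ^ (m - 1) * ‖T‖` with `δ = 1 / (2m) - 1 / p`. Since `c` and `∏ X_l` are
both probabilities, the left-hand side is at least one by convexity (`FormBound.rpow_sum_le`). For
`m < p ≤ 2m` the same weighting reduces the exponent `p / (p - m)` to the case `p = 2m`, because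
`X_l ≥ c` (`FormBound.rpow_sum_le_of_le`). The remaining `(r, p)` follow by Hölder's inequality,
monotonicity of `ℓ_r`-norms, and passing to a larger `p`, which costs a power of `n`
(`FormBound.mono_exponent`).

*Optimality.* A form with a single coefficient gives `s ≥ 0`, the diagonal form `∑ x¹ᵢ ⋯ xᵐᵢ`
gives `s ≥ β`, and random signs give `s ≥ α`: by a union bound over a grid some array of signs has
norm `O(√(n log n))` on `ℓ_2^n` (`exists_sign_formBound`), and the logarithm does not affect the
exponent. Both are transferred to `ℓ_p^n` by `FormBound.mono_exponent`.
-/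

/-! ### Khinchine's inequality with constant `√2` -/

/-- The scalar `±1` encoded by a Boolean. -/
def boolSign (𝕜 : Type*) [RCLike 𝕜] (b : Bool) : 𝕜 := if b then 1 else -1

theorem norm_boolSign {𝕜 : Type*} [RCLike 𝕜] (b : Bool) : ‖boolSign 𝕜 b‖ = 1 := by
  cases b <;> simp [boolSign]

theorem boolSign_not {𝕜 : Type*} [RCLike 𝕜] (b : Bool) : boolSign 𝕜 (!b) = -boolSign 𝕜 b := by
  cases b <;> simp [boolSign]

theorem sum_pi_fin_succ {M α : Type*} [AddCommMonoid M] [Fintype α] {d : ℕ}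
    (F : (Fin (d + 1) → α) → M) :
    ∑ j, F j = ∑ i : α, ∑ j : Fin d → α, F (Fin.cons i j) := by
  rw [← (Fin.consEquiv (fun _ : Fin (d + 1) => α)).sum_comp, Fintype.sum_prod_type]
  simp [Fin.consEquiv]

theorem sum_cube_succ {M : Type*} [AddCommMonoid M] {n : ℕ} (F : (Fin (n + 1) → Bool) → M) :
    ∑ ε, F ε = ∑ ε : Fin n → Bool, (F (Fin.cons true ε) + F (Fin.cons false ε)) := by
  simp [sum_pi_fin_succ, Finset.sum_add_distrib]

/-- The point of the discrete cube `ε` with its `i`-th coordinate reversed. -/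
def flipAt {n : ℕ} (i : Fin n) (ε : Fin n → Bool) : Fin n → Bool := Function.update ε i (!ε i)

theorem flipAt_zero_cons {n : ℕ} (b : Bool) (ε : Fin n → Bool) :
    flipAt 0 (Fin.cons b ε : Fin (n + 1) → Bool) = Fin.cons (!b) ε := by
  simp [flipAt]

theorem flipAt_succ_cons {n : ℕ} (b : Bool) (ε : Fin n → Bool) (i : Fin n) :
    flipAt i.succ (Fin.cons b ε : Fin (n + 1) → Bool) = Fin.cons b (flipAt i ε) := by
  simp [flipAt, Fin.cons_update]

theorem flipAt_flipAt {n : ℕ} (i : Fin n) (ε : Fin n → Bool) : flipAt i (flipAt i ε) = ε := by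
  simp [flipAt]

theorem not_cons {n : ℕ} (b : Bool) (ε : Fin n → Bool) :
    (fun i => !(Fin.cons b ε : Fin (n + 1) → Bool) i) = Fin.cons (!b) (fun i => !ε i) := by
  funext i
  refine Fin.cases ?_ (fun i => ?_) i <;> simp

/-- The (unnormalized) Dirichlet energy of a function on the discrete cube. -/
def cubeEnergy {n : ℕ} (f : (Fin n → Bool) → ℝ) : ℝ :=
  ∑ ε, ∑ i, (f ε - f (flipAt i ε)) ^ 2

theorem cubeEnergy_nonneg {n : ℕ} (f : (Fin n → Bool) → ℝ) : 0 ≤ cubeEnergy f :=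
  Finset.sum_nonneg fun _ _ => Finset.sum_nonneg fun _ _ => sq_nonneg _

/-- The energy splits along the decomposition `f = g ± h` with respect to the first coordinate. -/
theorem cubeEnergy_succ {n : ℕ} (f : (Fin (n + 1) → Bool) → ℝ) :
    cubeEnergy f = 2 * cubeEnergy (fun ε => (f (Fin.cons true ε) + f (Fin.cons false ε)) / 2)
      + 2 * cubeEnergy (fun ε => (f (Fin.cons true ε) - f (Fin.cons false ε)) / 2)
      + 8 * ∑ ε : Fin n → Bool, ((f (Fin.cons true ε) - f (Fin.cons false ε)) / 2) ^ 2 := by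
  unfold cubeEnergy
  rw [sum_cube_succ]
  simp only [Finset.mul_sum, ← Finset.sum_add_distrib]
  refine Finset.sum_congr rfl fun ε _ => ?_
  simp only [Fin.sum_univ_succ, flipAt_zero_cons, flipAt_succ_cons, Bool.not_true, Bool.not_false]
  have : ∑ i : Fin n, ((f (Fin.cons true ε) - f (Fin.cons true (flipAt i ε))) ^ 2
      + (f (Fin.cons false ε) - f (Fin.cons false (flipAt i ε))) ^ 2)
      = ∑ i : Fin n, (2 * ((f (Fin.cons true ε) + f (Fin.cons false ε)) / 2
          - (f (Fin.cons true (flipAt i ε)) + f (Fin.cons false (flipAt i ε))) / 2) ^ 2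
        + 2 * ((f (Fin.cons true ε) - f (Fin.cons false ε)) / 2
          - (f (Fin.cons true (flipAt i ε)) - f (Fin.cons false (flipAt i ε))) / 2) ^ 2) :=
    Finset.sum_congr rfl fun i _ => by ring
  linear_combination this

theorem sum_sq_cube_succ {n : ℕ} (f : (Fin (n + 1) → Bool) → ℝ) :
    ∑ ε, f ε ^ 2 = 2 * ∑ ε : Fin n → Bool, ((f (Fin.cons true ε) + f (Fin.cons false ε)) / 2) ^ 2
      + 2 * ∑ ε : Fin n → Bool, ((f (Fin.cons true ε) - f (Fin.cons false ε)) / 2) ^ 2 := by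
  rw [sum_cube_succ, Finset.mul_sum, Finset.mul_sum, ← Finset.sum_add_distrib]
  exact Finset.sum_congr rfl fun ε _ => by ring

/-- Poincaré inequality for odd functions on the cube. -/
theorem cubeEnergy_ge_of_odd {n : ℕ} (f : (Fin n → Bool) → ℝ)
    (hf : ∀ ε, f (fun i => !ε i) = -f ε) : 4 * ∑ ε, f ε ^ 2 ≤ cubeEnergy f := by
  induction n with
  | zero =>
    have h0 : ∀ ε, f ε = 0 := fun ε => by
      have := hf ε
      rw [Subsingleton.elim (fun i => !ε i) ε] at this
      linarith
    simp [h0, cubeEnergy_nonneg]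
  | succ n ih =>
    rw [cubeEnergy_succ, sum_sq_cube_succ]
    have h1 : ∀ ε : Fin n → Bool, f (Fin.cons true fun i => !ε i) = -f (Fin.cons false ε) :=
      fun ε => by rw [← hf, not_cons]; rfl
    have h2 : ∀ ε : Fin n → Bool, f (Fin.cons false fun i => !ε i) = -f (Fin.cons true ε) :=
      fun ε => by rw [← hf, not_cons]; rfl
    have := ih (fun ε => (f (Fin.cons true ε) + f (Fin.cons false ε)) / 2)
      (fun ε => by simp only [h1, h2]; ring)
    have := cubeEnergy_nonneg fun ε : Fin n → Bool =>
      (f (Fin.cons true ε) - f (Fin.cons false ε)) / 2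
    linarith

/-- For even functions on the cube the Poincaré inequality improves by a factor two, since there
are no Walsh coefficients of order one. -/
theorem cubeEnergy_ge_of_even {n : ℕ} (f : (Fin n → Bool) → ℝ)
    (hf : ∀ ε, f (fun i => !ε i) = f ε) :
    8 * (∑ ε, f ε ^ 2 - (∑ ε, f ε) ^ 2 / 2 ^ n) ≤ cubeEnergy f := by
  induction n with
  | zero => simp [cubeEnergy]
  | succ n ih =>
    rw [cubeEnergy_succ, sum_sq_cube_succ]
    have h1 : ∀ ε : Fin n → Bool, f (Fin.cons true fun i => !ε i) = f (Fin.cons false ε) :=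
      fun ε => by rw [← hf, not_cons]; simp
    have h2 : ∀ ε : Fin n → Bool, f (Fin.cons false fun i => !ε i) = f (Fin.cons true ε) :=
      fun ε => by rw [← hf, not_cons]; simp
    have hg := ih (fun ε => (f (Fin.cons true ε) + f (Fin.cons false ε)) / 2)
      (fun ε => by simp only [h1, h2]; ring)
    have hh := cubeEnergy_ge_of_odd
      (fun ε : Fin n → Bool => (f (Fin.cons true ε) - f (Fin.cons false ε)) / 2)
      (fun ε => by simp only [h1, h2]; ring)
    have hs : ∑ ε, f ε
        = 2 * ∑ ε : Fin n → Bool, (f (Fin.cons true ε) + f (Fin.cons false ε)) / 2 := by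
      rw [sum_cube_succ, Finset.mul_sum]
      exact Finset.sum_congr rfl fun ε _ => by ring
    rw [hs]
    have : (2 * ∑ ε : Fin n → Bool, (f (Fin.cons true ε) + f (Fin.cons false ε)) / 2) ^ 2
        / 2 ^ (n + 1)
        = 2 * ((∑ ε : Fin n → Bool, (f (Fin.cons true ε) + f (Fin.cons false ε)) / 2) ^ 2
          / 2 ^ n) := by
      rw [pow_succ (2 : ℝ) n]
      field_simp
    linarith

/-- Kahane's inequality `𝔼‖∑ εᵢ vᵢ‖² ≤ 2 (𝔼‖∑ εᵢ vᵢ‖)²` in any normed space. The function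
`ε ↦ ‖∑ εᵢ vᵢ‖` is even, and by the triangle inequality its energy is at most that of a function
of Walsh degree one; comparison with `cubeEnergy_ge_of_even` gives the constant. -/
theorem sum_sq_norm_sign_sum_le {𝕜 E : Type*} [RCLike 𝕜] [NormedAddCommGroup E] [NormedSpace 𝕜 E]
    {n : ℕ} (v : Fin n → E) :
    ∑ ε : Fin n → Bool, ‖∑ i, boolSign 𝕜 (ε i) • v i‖ ^ 2
      ≤ 2 * (∑ ε : Fin n → Bool, ‖∑ i, boolSign 𝕜 (ε i) • v i‖) ^ 2 / 2 ^ n := by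
  set f : (Fin n → Bool) → ℝ := fun ε => ‖∑ i, boolSign 𝕜 (ε i) • v i‖ with hf
  have heven : ∀ ε, f (fun i => !ε i) = f ε := fun ε => by
    simp only [hf, boolSign_not, neg_smul, Finset.sum_neg_distrib, norm_neg]
  have hflip : ∀ ε, ((n : ℝ) - 2) * f ε ≤ ∑ i, f (flipAt i ε) := by
    intro ε
    have hone : ∀ i, ∑ j, boolSign 𝕜 (flipAt i ε j) • v j
        = ∑ j, boolSign 𝕜 (ε j) • v j - (2 : 𝕜) • (boolSign 𝕜 (ε i) • v i) := by
      intro i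
      rw [← Finset.add_sum_erase _ _ (Finset.mem_univ i),
        ← Finset.add_sum_erase _ (fun j => boolSign 𝕜 (ε j) • v j) (Finset.mem_univ i)]
      have : ∑ j ∈ Finset.univ.erase i, boolSign 𝕜 (flipAt i ε j) • v j
          = ∑ j ∈ Finset.univ.erase i, boolSign 𝕜 (ε j) • v j :=
        Finset.sum_congr rfl fun j hj => by simp [flipAt, Finset.ne_of_mem_erase hj]
      rw [this]
      simp only [flipAt, Function.update_self, boolSign_not, neg_smul, two_smul]
      abel
    have htot : ∑ i, ∑ j, boolSign 𝕜 (flipAt i ε j) • v j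
        = ((n : 𝕜) - 2) • ∑ j, boolSign 𝕜 (ε j) • v j := by
      simp only [hone, Finset.sum_sub_distrib, ← Finset.smul_sum, Finset.sum_const,
        Finset.card_univ, Fintype.card_fin, sub_smul, Nat.cast_smul_eq_nsmul]
    have hn : (n : ℝ) - 2 ≤ ‖(n : 𝕜) - 2‖ := by
      have : ((n : 𝕜) - 2) = (((n : ℝ) - 2 : ℝ) : 𝕜) := by push_cast; rfl
      rw [this, RCLike.norm_ofReal]
      exact le_abs_self _
    calc ((n : ℝ) - 2) * f ε ≤ ‖(n : 𝕜) - 2‖ * f ε :=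
          mul_le_mul_of_nonneg_right hn (norm_nonneg _)
      _ = ‖∑ i, ∑ j, boolSign 𝕜 (flipAt i ε j) • v j‖ := by rw [htot, norm_smul]
      _ ≤ ∑ i, f (flipAt i ε) := norm_sum_le _ _
  have hup : cubeEnergy f ≤ 4 * ∑ ε, f ε ^ 2 := by
    have hshift : ∀ i, ∑ ε, f (flipAt i ε) ^ 2 = ∑ ε, f ε ^ 2 := fun i =>
      Equiv.sum_comp (Function.Involutive.toPerm (flipAt i) (flipAt_flipAt i)) (fun ε => f ε ^ 2)
    have h1 : cubeEnergy f
        = 2 * n * ∑ ε, f ε ^ 2 - 2 * ∑ ε, f ε * ∑ i, f (flipAt i ε) := by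
      have : cubeEnergy f = ∑ ε, ∑ i : Fin n, f ε ^ 2 + ∑ i, ∑ ε, f (flipAt i ε) ^ 2
          - 2 * ∑ ε, f ε * ∑ i, f (flipAt i ε) := by
        rw [Finset.sum_comm (f := fun i ε => f (flipAt i ε) ^ 2)]
        simp only [cubeEnergy, Finset.mul_sum, ← Finset.sum_add_distrib,
          ← Finset.sum_sub_distrib]
        exact Finset.sum_congr rfl fun _ _ => Finset.sum_congr rfl fun _ _ => by ring
      rw [this]
      simp only [hshift, Finset.sum_const, Finset.card_univ, Fintype.card_fin, nsmul_eq_mul,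
        ← Finset.mul_sum]
      ring
    have h2 : ((n : ℝ) - 2) * ∑ ε, f ε ^ 2 ≤ ∑ ε, f ε * ∑ i, f (flipAt i ε) := by
      rw [Finset.mul_sum]
      refine Finset.sum_le_sum fun ε _ => ?_
      calc ((n : ℝ) - 2) * f ε ^ 2 = f ε * (((n : ℝ) - 2) * f ε) := by ring
        _ ≤ _ := mul_le_mul_of_nonneg_left (hflip ε) (norm_nonneg _)
    linarith
  have hlow := cubeEnergy_ge_of_even f heven
  rw [mul_div_assoc]
  linarith

theorem sum_norm_sign_sum_sq {𝕜 E : Type*} [RCLike 𝕜] [NormedAddCommGroup E]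
    [InnerProductSpace 𝕜 E] {n : ℕ} (v : Fin n → E) (u : E) :
    ∑ ε : Fin n → Bool, ‖u + ∑ i, boolSign 𝕜 (ε i) • v i‖ ^ 2
      = 2 ^ n * (‖u‖ ^ 2 + ∑ i, ‖v i‖ ^ 2) := by
  induction n generalizing u with
  | zero => simp
  | succ n ih =>
    rw [sum_cube_succ, Finset.sum_add_distrib]
    simp only [Fin.sum_univ_succ, Fin.cons_zero, Fin.cons_succ, ← add_assoc]
    rw [ih, ih]
    have := parallelogram_law_with_norm 𝕜 u (v 0)
    simp only [boolSign, if_true, one_smul, neg_smul, Bool.false_eq_true, if_false]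
    rw [← sub_eq_add_neg, pow_succ]
    linear_combination (2 : ℝ) ^ n * this

/-- Khinchine's inequality `(∑ ‖vᵢ‖²)^{1/2} ≤ √2 𝔼‖∑ εᵢ vᵢ‖` in an inner product space. -/
theorem sqrt_sum_norm_sq_le {𝕜 E : Type*} [RCLike 𝕜] [NormedAddCommGroup E]
    [InnerProductSpace 𝕜 E] {n : ℕ} (v : Fin n → E) :
    √(∑ i, ‖v i‖ ^ 2)
      ≤ √2 * ((∑ ε : Fin n → Bool, ‖∑ i, boolSign 𝕜 (ε i) • v i‖) / 2 ^ n) := by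
  have h1 := sum_sq_norm_sign_sum_le (𝕜 := 𝕜) v
  have h2 := sum_norm_sign_sum_sq (𝕜 := 𝕜) v 0
  simp only [zero_add, norm_zero, ne_eq, OfNat.ofNat_ne_zero, not_false_eq_true, zero_pow] at h2
  rw [h2] at h1
  have hS : 0 ≤ ∑ ε : Fin n → Bool, ‖∑ i, boolSign 𝕜 (ε i) • v i‖ :=
    Finset.sum_nonneg fun _ _ => norm_nonneg _
  rw [Real.sqrt_le_left (by positivity), mul_pow, Real.sq_sqrt (by norm_num), div_pow]
  rw [le_div_iff₀ (by positivity)] at h1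
  rw [mul_div_assoc', le_div_iff₀ (by positivity)]
  linarith

/-- Khinchine's inequality for multi-indexed Rademacher sums, by iterating the Hilbert-space valued
inequality over the coordinates of the multi-index. -/
theorem sqrt_sum_multi_le {𝕜 : Type*} [RCLike 𝕜] {n : ℕ} (d : ℕ) (b : (Fin d → Fin n) → 𝕜) :
    √(∑ j, ‖b j‖ ^ 2) ≤ √2 ^ d * ((∑ ε : Fin d → Fin n → Bool,
      ‖∑ j, b j * ∏ l, boolSign 𝕜 (ε l (j l))‖) / (2 ^ n) ^ d) := by
  induction d with
  | zero => simp
  | succ d ih =>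
    let v : Fin n → EuclideanSpace 𝕜 (Fin d → Fin n) :=
      fun i => WithLp.toLp 2 fun j => b (Fin.cons i j)
    have hv : ∀ i, ‖v i‖ ^ 2 = ∑ j : Fin d → Fin n, ‖b (Fin.cons i j)‖ ^ 2 := fun i => by
      rw [EuclideanSpace.norm_sq_eq]
    have hK := sqrt_sum_norm_sq_le (𝕜 := 𝕜) v
    rw [sum_pi_fin_succ, sum_pi_fin_succ]
    simp only [hv] at hK
    refine hK.trans ?_
    have hstep : ∀ η : Fin n → Bool, ‖∑ i, boolSign 𝕜 (η i) • v i‖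
        ≤ √2 ^ d * ((∑ ε : Fin d → Fin n → Bool,
          ‖∑ j, b j * ∏ l, boolSign 𝕜 ((Fin.cons η ε : Fin (d + 1) → Fin n → Bool) l (j l))‖)
            / (2 ^ n) ^ d) := by
      intro η
      have := ih (fun j => ∑ i, boolSign 𝕜 (η i) * b (Fin.cons i j))
      rw [EuclideanSpace.norm_eq]
      refine le_of_eq_of_le ?_ (this.trans (le_of_eq ?_))
      · simp [v]
      · congr 2
        refine Finset.sum_congr rfl fun ε _ => ?_
        rw [sum_pi_fin_succ (fun j : Fin (d + 1) → Fin n => _), Finset.sum_comm]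
        congr 1
        refine Finset.sum_congr rfl fun j _ => ?_
        rw [Finset.sum_mul]
        refine Finset.sum_congr rfl fun i _ => ?_
        rw [Fin.prod_univ_succ]
        simp only [Fin.cons_zero, Fin.cons_succ]
        ring
    calc √2 * ((∑ η : Fin n → Bool, ‖∑ i, boolSign 𝕜 (η i) • v i‖) / 2 ^ n)
        ≤ √2 * ((∑ η : Fin n → Bool, √2 ^ d * ((∑ ε : Fin d → Fin n → Bool,
          ‖∑ j, b j * ∏ l, boolSign 𝕜 ((Fin.cons η ε : Fin (d + 1) → Fin n → Bool) l (j l))‖)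
            / (2 ^ n) ^ d)) / 2 ^ n) := by
          gcongr with η _
          exact hstep η
      _ = _ := by
          rw [← Finset.mul_sum, ← Finset.sum_div, pow_succ, pow_succ]
          field_simp

/-! ### Arrays of coefficients and weighted bounds -/

/-- The array `a` is the coefficient array of an `m`-linear form of norm at most `B` on `ℓ_p^n`,
where `t = 1 / p`. The unit ball is described by domination: `y` lies in the unit ball of `ℓ_p^n`
iff `|y i| ≤ (w i) ^ t` for a nonnegative `w` of total mass at most one. As `0 ^ 0 = 1`, this
includes `p = ∞`, with `t = 0`. -/
def FormBound {𝕜 : Type*} [RCLike 𝕜] {m n : ℕ} (a : (Fin m → Fin n) → 𝕜) (t B : ℝ) : Prop :=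
  ∀ (w : Fin m → Fin n → ℝ) (y : Fin m → Fin n → 𝕜), (∀ l i, 0 ≤ w l i) →
    (∀ l, ∑ i, w l i ≤ 1) → (∀ l i, ‖y l i‖ ≤ w l i ^ t) → ‖∑ j, a j * ∏ l, y l (j l)‖ ≤ B

/-- The `k`-th marginal of an array. -/
def marginal {m n : ℕ} (c : (Fin m → Fin n) → ℝ) (k : Fin m) (i : Fin n) : ℝ :=
  ∑ j with j k = i, c j

section
variable {𝕜 : Type*} [RCLike 𝕜] {m n : ℕ}

theorem FormBound.nonneg {a : (Fin m → Fin n) → 𝕜} {t B : ℝ} (h : FormBound a t B) : 0 ≤ B :=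
  (norm_nonneg _).trans (h 0 0 (fun _ _ => le_rfl) (fun _ => by simp)
    (fun _ _ => by simpa using Real.rpow_nonneg le_rfl t))

theorem FormBound.smul {a : (Fin m → Fin n) → 𝕜} {t B : ℝ} (h : FormBound a t B) {s : ℝ}
    (hs : 0 ≤ s) : FormBound (fun j => (s : 𝕜) * a j) t (s * B) := by
  intro w y hw hw1 hy
  simp only [mul_assoc, ← Finset.mul_sum]
  rw [norm_mul, RCLike.norm_ofReal, abs_of_nonneg hs]
  exact mul_le_mul_of_nonneg_left (h w y hw hw1 hy) hs

/-- Multiplication by `v ^ (s - s')` maps the unit ball of exponent `s'` into the one of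
exponent `s`; this is the weighted inequality of the means. -/
theorem FormBound.weight {a : (Fin m → Fin n) → 𝕜} {s s' B : ℝ} (h : FormBound a s B)
    (hs' : 0 ≤ s') (hss : s' ≤ s) {v : Fin m → Fin n → ℝ} (hv : ∀ l i, 0 ≤ v l i)
    (hv1 : ∀ l, ∑ i, v l i ≤ 1) :
    FormBound (fun j => a j * ((∏ l, v l (j l) ^ (s - s') : ℝ) : 𝕜)) s' B := by
  intro w y hw hw1 hy
  have key : ∑ j, a j * ((∏ l, v l (j l) ^ (s - s') : ℝ) : 𝕜) * ∏ l, y l (j l)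
      = ∑ j, a j * ∏ l, (((v l (j l) ^ (s - s') : ℝ) : 𝕜) * y l (j l)) := by
    refine Finset.sum_congr rfl fun j _ => ?_
    rw [Finset.prod_mul_distrib, mul_assoc]
    push_cast
    rfl
  rw [key]
  rcases (hs'.trans hss).eq_or_lt with h0 | hs
  · have : s' = 0 := le_antisymm (h0 ▸ hss) hs'
    subst this
    subst h0
    exact h w (fun l i => ((v l i ^ (0 - 0 : ℝ) : ℝ) : 𝕜) * y l i) hw hw1
      fun l i => by simpa using hy l i
  · set θ := s' / s with hθ
    have hθ0 : 0 ≤ θ := div_nonneg hs' hs.le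
    have hθ1 : θ ≤ 1 := (div_le_one hs).2 hss
    refine h (fun l i => (1 - θ) * v l i + θ * w l i)
      (fun l i => ((v l i ^ (s - s') : ℝ) : 𝕜) * y l i) (fun l i => ?_) (fun l => ?_)
      (fun l i => ?_)
    · have := hv l i
      have := hw l i
      have : 0 ≤ 1 - θ := by linarith
      positivity
    · rw [Finset.sum_add_distrib, ← Finset.mul_sum, ← Finset.mul_sum]
      nlinarith [hv1 l, hw1 l]
    · rw [norm_mul, RCLike.norm_ofReal, abs_of_nonneg (Real.rpow_nonneg (hv l i) _)]
      have hm := Real.geom_mean_le_arith_mean2_weighted (sub_nonneg.2 hθ1) hθ0 (hv l i) (hw l i)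
        (by ring)
      calc v l i ^ (s - s') * ‖y l i‖ ≤ v l i ^ (s - s') * w l i ^ s' :=
            mul_le_mul_of_nonneg_left (hy l i) (Real.rpow_nonneg (hv l i) _)
        _ = (v l i ^ (1 - θ) * w l i ^ θ) ^ s := by
            rw [Real.mul_rpow (Real.rpow_nonneg (hv l i) _) (Real.rpow_nonneg (hw l i) _),
              ← Real.rpow_mul (hv l i), ← Real.rpow_mul (hw l i), sub_mul, one_mul,
              hθ, div_mul_cancel₀ _ hs.ne']
        _ ≤ _ := Real.rpow_le_rpow
            (mul_nonneg (Real.rpow_nonneg (hv l i) _) (Real.rpow_nonneg (hw l i) _)) hm hs.le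

/-- Passing to a smaller exponent `1 / p` costs a power of `n`: the special case of uniform
weights in `FormBound.weight`. -/
theorem FormBound.mono_exponent {a : (Fin m → Fin n) → 𝕜} {s s' B : ℝ} (h : FormBound a s B)
    (hn : 0 < n) (hs' : 0 ≤ s') (hss : s' ≤ s) :
    FormBound a s' ((n : ℝ) ^ (m * (s - s')) * B) := by
  have hn' : (0 : ℝ) < n := by exact_mod_cast hn
  have h1 := (h.weight hs' hss (v := fun _ _ => (n : ℝ)⁻¹) (fun _ _ => by positivity)
    (fun _ => by simp [hn.ne'])).smul (s := (n : ℝ) ^ (m * (s - s'))) (by positivity)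
  convert h1 using 2 with j
  rw [Finset.prod_const, Finset.card_univ, Fintype.card_fin, ← Real.rpow_natCast,
    ← Real.rpow_mul (by positivity), mul_comm (s - s'), Real.inv_rpow hn'.le, mul_left_comm,
    ← RCLike.ofReal_mul, mul_inv_cancel₀ (by positivity)]
  simp

theorem sum_marginal (c : (Fin m → Fin n) → ℝ) (k : Fin m) : ∑ i, marginal c k i = ∑ j, c j :=
  Finset.sum_fiberwise _ _ _

theorem le_marginal {c : (Fin m → Fin n) → ℝ} (hc : ∀ j, 0 ≤ c j) (k : Fin m)
    (j : Fin m → Fin n) : c j ≤ marginal c k (j k) :=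
  Finset.single_le_sum (f := c) (fun j _ => hc j) (by simp)

theorem marginal_nonneg {c : (Fin m → Fin n) → ℝ} (hc : ∀ j, 0 ≤ c j) (k : Fin m) (i : Fin n) :
    0 ≤ marginal c k i :=
  Finset.sum_nonneg fun j _ => hc j

theorem sum_pi_insertNth {M : Type*} [AddCommMonoid M] {d : ℕ} (k : Fin (d + 1))
    (F : (Fin (d + 1) → Fin n) → M) :
    ∑ j, F j = ∑ i : Fin n, ∑ j : Fin d → Fin n, F (k.insertNth i j) := by
  rw [← (Fin.insertNthEquiv (fun _ => Fin n) k).sum_comp, Fintype.sum_prod_type]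
  rfl

theorem marginal_eq_sum_insertNth {d : ℕ} (c : (Fin (d + 1) → Fin n) → ℝ) (k : Fin (d + 1))
    (i : Fin n) : marginal c k i = ∑ j : Fin d → Fin n, c (k.insertNth i j) := by
  rw [marginal, Finset.sum_filter, sum_pi_insertNth k, Finset.sum_eq_single i]
  · simp
  · intro b _ hb
    simp [hb]
  · simp

/-- The mixed `(ℓ₁, ℓ₂)` inequality of Littlewood and Bohnenblust–Hille for forms on `ℓ_∞^n`,
from Khinchine's inequality in all variables but the `k`-th. -/
theorem FormBound.sum_sqrt_marginal_le {d : ℕ} {a : (Fin (d + 1) → Fin n) → 𝕜} {B : ℝ}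
    (h : FormBound a 0 B) (k : Fin (d + 1)) :
    ∑ i, √(marginal (fun j => ‖a j‖ ^ 2) k i) ≤ √2 ^ d * B := by
  have hε : ∀ ε : Fin d → Fin n → Bool,
      ∑ i, ‖∑ j : Fin d → Fin n, a (k.insertNth i j) * ∏ l, boolSign 𝕜 (ε l (j l))‖ ≤ B := by
    intro ε
    set φ : Fin n → 𝕜 := fun i =>
      ∑ j : Fin d → Fin n, a (k.insertNth i j) * ∏ l, boolSign 𝕜 (ε l (j l)) with hφ
    -- `u` carries the phases that turn `φ i` into `‖φ i‖`
    let u : Fin n → 𝕜 := fun i => (starRingEnd 𝕜) (φ i) / (‖φ i‖ : 𝕜)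
    have hu : ∀ i, ‖u i‖ ≤ 1 := fun i => by
      simp only [u, norm_div, RCLike.norm_conj, norm_algebraMap', norm_norm]
      exact div_self_le_one _
    have huφ : ∀ i, u i * φ i = (‖φ i‖ : 𝕜) := fun i => by
      simp only [u]
      by_cases h0 : φ i = 0
      · simp [h0]
      · have : (‖φ i‖ : 𝕜) ≠ 0 := by simpa using h0
        rw [div_mul_eq_mul_div, RCLike.conj_mul, sq, mul_div_assoc, div_self this, mul_one]
    have hb := h 0 (k.insertNth u fun l i => boolSign 𝕜 (ε l i)) (fun _ _ => le_rfl)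
      (fun _ => by simp) (fun l i => by
        refine Fin.succAboveCases k ?_ (fun l => ?_) l
        · simpa using hu i
        · simp [norm_boolSign])
    have he : ∑ j, a j * ∏ l, (k.insertNth u (fun l i => boolSign 𝕜 (ε l i)) :
        Fin (d + 1) → Fin n → 𝕜) l (j l) = ((∑ i, ‖φ i‖ : ℝ) : 𝕜) := by
      rw [sum_pi_insertNth k]
      push_cast
      refine Finset.sum_congr rfl fun i _ => ?_
      refine Eq.trans ?_ (huφ i)
      rw [hφ, Finset.mul_sum]
      refine Finset.sum_congr rfl fun j _ => ?_
      rw [Fin.prod_univ_succAbove _ k]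
      simp only [Fin.insertNth_apply_same, Fin.insertNth_apply_succAbove]
      ring
    rw [he, RCLike.norm_ofReal] at hb
    exact (le_abs_self _).trans hb
  have hpow : (0 : ℝ) < (2 ^ n) ^ d := by positivity
  calc ∑ i, √(marginal (fun j => ‖a j‖ ^ 2) k i)
      ≤ ∑ i, √2 ^ d * ((∑ ε : Fin d → Fin n → Bool, ‖∑ j : Fin d → Fin n,
          a (k.insertNth i j) * ∏ l, boolSign 𝕜 (ε l (j l))‖) / (2 ^ n) ^ d) := by
        refine Finset.sum_le_sum fun i _ => ?_
        rw [marginal_eq_sum_insertNth]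
        exact sqrt_sum_multi_le d _
    _ = √2 ^ d * ((∑ ε : Fin d → Fin n → Bool, ∑ i, ‖∑ j : Fin d → Fin n,
          a (k.insertNth i j) * ∏ l, boolSign 𝕜 (ε l (j l))‖) / (2 ^ n) ^ d) := by
        rw [← Finset.mul_sum, ← Finset.sum_div, Finset.sum_comm]
    _ ≤ √2 ^ d * ((∑ ε : Fin d → Fin n → Bool, B) / (2 ^ n) ^ d) := by
        gcongr with ε _
        exact hε ε
    _ = √2 ^ d * B := by
        simp only [Finset.sum_const, Finset.card_univ, Fintype.card_pi, Fintype.card_bool,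
          Finset.prod_const, Fintype.card_fin, nsmul_eq_mul]
        push_cast
        field_simp

end

/-! ### Hardy–Littlewood inequalities for arrays -/

section
variable {𝕜 : Type*} [RCLike 𝕜] {m n : ℕ}

theorem sum_prod_pi_fin (X : Fin m → Fin n → ℝ) :
    ∑ j : Fin m → Fin n, ∏ l, X l (j l) = ∏ l, ∑ i, X l i := by
  rw [Finset.prod_univ_sum, Fintype.piFinset_univ]

/-- Weighted arithmetic–geometric mean inequality, as the tangent line at `c = P` of the convex
function `c ↦ c ^ (1 + δ) * P ^ (-δ)`. -/
theorem tangent_le_rpow {c P δ : ℝ} (hc : 0 < c) (hP : 0 < P) (hδ : 0 ≤ δ) :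
    (1 + δ) * c - δ * P ≤ c ^ (1 + δ) * P ^ (-δ) := by
  have h1 : 0 < 1 + δ := by linarith
  have h := Real.geom_mean_le_arith_mean2_weighted (w₁ := 1 / (1 + δ)) (w₂ := δ / (1 + δ))
    (p₁ := c ^ (1 + δ) * P ^ (-δ)) (p₂ := P) (by positivity) (by positivity) (by positivity)
    hP.le (by field_simp)
  have e : (c ^ (1 + δ) * P ^ (-δ)) ^ (1 / (1 + δ)) * P ^ (δ / (1 + δ)) = c := by
    rw [Real.mul_rpow (by positivity) (by positivity), ← Real.rpow_mul hc.le,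
      ← Real.rpow_mul hP.le, mul_assoc, ← Real.rpow_add hP, mul_one_div_cancel h1.ne',
      Real.rpow_one]
    rw [show -δ * (1 / (1 + δ)) + δ / (1 + δ) = 0 by ring, Real.rpow_zero, mul_one]
  rw [e] at h
  have := mul_le_mul_of_nonneg_left h h1.le
  have e2 : (1 + δ) * (1 / (1 + δ) * (c ^ (1 + δ) * P ^ (-δ)) + δ / (1 + δ) * P)
      = c ^ (1 + δ) * P ^ (-δ) + δ * P := by field_simp
  linarith

/-- A bound for normalized arrays gives the homogeneous inequality. -/
theorem rpow_sum_le_of_normalized {t q K : ℝ} (hq : 0 < q) (hK : 0 ≤ K)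
    (H : ∀ (a : (Fin m → Fin n) → 𝕜) (B : ℝ), FormBound a t B → ∑ j, ‖a j‖ ^ (1 / q) = 1 →
      1 ≤ K * B)
    {a : (Fin m → Fin n) → 𝕜} {B : ℝ} (h : FormBound a t B) :
    (∑ j, ‖a j‖ ^ (1 / q)) ^ q ≤ K * B := by
  set S := ∑ j, ‖a j‖ ^ (1 / q) with hS
  have hS0 : 0 ≤ S := Finset.sum_nonneg fun j _ => by positivity
  rcases hS0.eq_or_lt with h0 | hpos
  · rw [← h0, Real.zero_rpow hq.ne']
    exact mul_nonneg hK h.nonneg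
  · have hSq : 0 < S ^ q := by positivity
    have h1 := H _ _ (h.smul (inv_nonneg.2 hSq.le)) (by
      have : ∀ j, ‖(((S ^ q)⁻¹ : ℝ) : 𝕜) * a j‖ ^ (1 / q) = S⁻¹ * ‖a j‖ ^ (1 / q) := fun j => by
        rw [norm_mul, RCLike.norm_ofReal, abs_of_pos (inv_pos.2 hSq),
          Real.mul_rpow (by positivity) (by positivity), Real.inv_rpow hSq.le,
          ← Real.rpow_mul hpos.le, mul_one_div_cancel hq.ne', Real.rpow_one]
      simp only [this, ← Finset.mul_sum]
      exact inv_mul_cancel₀ hpos.ne')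
    rw [mul_left_comm, ← div_eq_inv_mul, le_div_iff₀ hSq, one_mul] at h1
    exact h1

/-- The case `p ≥ 2m` for normalized arrays: with `c = ‖a‖ ^ ρ`, the mixed inequality is applied to
the array weighted by the marginals of `c`, and the bounds for the `m` choices of the
distinguished variable are averaged. -/
theorem one_le_of_sum_rpow_eq_one {d : ℕ} {a : (Fin (d + 1) → Fin n) → 𝕜} {t B : ℝ} (ht : 0 ≤ t)
    (htd : t ≤ 1 / (2 * (d + 1))) (h : FormBound a t B)
    (ha : ∑ j, ‖a j‖ ^ (1 / (1 / 2 + 1 / (2 * ((d : ℝ) + 1)) - t)) = 1) : 1 ≤ √2 ^ d * B := by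
  set δ : ℝ := 1 / (2 * ((d : ℝ) + 1)) - t with hδ
  have hδ0 : 0 ≤ δ := sub_nonneg.2 htd
  have hq : 1 / 2 + 1 / (2 * ((d : ℝ) + 1)) - t = 1 / 2 + δ := by rw [hδ]; ring
  rw [hq] at ha
  have hq0 : 0 < 1 / 2 + δ := by linarith
  set c : (Fin (d + 1) → Fin n) → ℝ := fun j => ‖a j‖ ^ (1 / (1 / 2 + δ)) with hc
  have hc0 : ∀ j, 0 ≤ c j := fun j => Real.rpow_nonneg (norm_nonneg _) _
  set X := marginal c with hX
  have hX0 : ∀ l i, 0 ≤ X l i := marginal_nonneg hc0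
  have hX1 : ∀ l, ∑ i, X l i = 1 := fun l => (sum_marginal c l).trans ha
  set G : (Fin (d + 1) → Fin n) → ℝ := fun j => ‖a j‖ * ∏ l, X l (j l) ^ t with hG
  have hG0 : ∀ j, 0 ≤ G j := fun j =>
    mul_nonneg (norm_nonneg _) (Finset.prod_nonneg fun l _ => Real.rpow_nonneg (hX0 _ _) _)
  -- the mixed inequality for the array weighted by the marginals, whose entries have modulus `G j`
  have hmix : ∀ k, ∑ i, √(marginal (fun j => G j ^ 2) k i) ≤ √2 ^ d * B := by
    intro k
    have := (h.weight le_rfl ht hX0 fun l => (hX1 l).le).sum_sqrt_marginal_le k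
    convert this using 6 with i _ j
    rw [norm_mul, RCLike.norm_ofReal, abs_of_nonneg
      (Finset.prod_nonneg fun l _ => Real.rpow_nonneg (hX0 _ _) _), sub_zero]
  -- Cauchy–Schwarz on each slice `j k = i`; a vanishing marginal is harmless since `0⁻¹ = 0`
  have hk : ∀ k, ∑ j, √(c j) * G j * (√(X k (j k)))⁻¹ ≤ √2 ^ d * B := by
    intro k
    refine le_trans ?_ (hmix k)
    rw [← Finset.sum_fiberwise _ (fun j => j k)]
    refine Finset.sum_le_sum fun i _ => ?_
    have hcs := Real.sum_mul_le_sqrt_mul_sqrt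
      (Finset.univ.filter fun j : Fin (d + 1) → Fin n => j k = i) (fun j => √(c j)) G
    have he : ∑ j with j k = i, √(c j) * G j * (√(X k (j k)))⁻¹
        = (∑ j with j k = i, √(c j) * G j) * (√(X k i))⁻¹ := by
      rw [Finset.sum_mul]
      refine Finset.sum_congr rfl fun j hj => ?_
      rw [(Finset.mem_filter.1 hj).2]
    simp only [Real.sq_sqrt (hc0 _)] at hcs
    rw [he]
    calc (∑ j with j k = i, √(c j) * G j) * (√(X k i))⁻¹
        ≤ √(X k i) * √(marginal (fun j => G j ^ 2) k i) * (√(X k i))⁻¹ :=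
          mul_le_mul_of_nonneg_right hcs (by positivity)
      _ = (√(X k i) / √(X k i)) * √(marginal (fun j => G j ^ 2) k i) := by ring
      _ ≤ 1 * √(marginal (fun j => G j ^ 2) k i) :=
          mul_le_mul_of_nonneg_right (div_self_le_one _) (Real.sqrt_nonneg _)
      _ = _ := one_mul _
  have hd : (0 : ℝ) < d + 1 := by positivity
  -- the geometric mean over `k` of `X k (j k) ^ (-1/2)` is `P ^ (-(t + δ))`, as `t + δ = 1 / (2m)`
  have hj : ∀ j, (1 + δ) * c j - δ * ∏ l, X l (j l)
      ≤ ∑ k : Fin (d + 1), 1 / ((d : ℝ) + 1) * (√(c j) * G j * (√(X k (j k)))⁻¹) := by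
    intro j
    have hP0 : 0 ≤ ∏ l, X l (j l) := Finset.prod_nonneg fun l _ => hX0 _ _
    rcases (hc0 j).eq_or_lt with h0 | hpos
    · rw [← h0]
      simp only [Real.sqrt_zero, zero_mul, mul_zero, Finset.sum_const_zero]
      nlinarith
    · have hXj : ∀ l, 0 < X l (j l) := fun l => hpos.trans_le (le_marginal hc0 l j)
      set P := ∏ l, X l (j l) with hP
      have hPpos : 0 < P := Finset.prod_pos fun l _ => hXj l
      have hamgm := Real.geom_mean_le_arith_mean_weighted Finset.univ
        (fun _ : Fin (d + 1) => 1 / ((d : ℝ) + 1)) (fun k => (√(X k (j k)))⁻¹)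
        (fun _ _ => by positivity)
        (by simp [mul_inv_cancel₀ hd.ne']) (fun k _ => by positivity)
      have hgeom : ∏ k, (√(X k (j k)))⁻¹ ^ (1 / ((d : ℝ) + 1)) = P ^ (-(t + δ)) := by
        rw [hP, ← Real.finsetProd_rpow _ _ fun l _ => (hXj l).le]
        refine Finset.prod_congr rfl fun k _ => ?_
        rw [Real.sqrt_eq_rpow, ← Real.rpow_neg (hXj k).le, ← Real.rpow_mul (hXj k).le]
        congr 1
        rw [hδ]
        field_simp
        ring
      have hcG : √(c j) * G j = c j ^ (1 + δ) * P ^ t := by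
        have : ‖a j‖ = c j ^ (1 / 2 + δ) := by
          rw [hc]
          simp only
          rw [← Real.rpow_mul (norm_nonneg _), one_div_mul_cancel hq0.ne', Real.rpow_one]
        rw [hG]
        simp only
        rw [this, Real.sqrt_eq_rpow, ← mul_assoc, ← Real.rpow_add hpos,
          Real.finsetProd_rpow _ _ fun l _ => (hXj l).le]
        congr 2
        ring
      calc (1 + δ) * c j - δ * P ≤ c j ^ (1 + δ) * P ^ (-δ) := tangent_le_rpow hpos hPpos hδ0
        _ = √(c j) * G j * ∏ k, (√(X k (j k)))⁻¹ ^ (1 / ((d : ℝ) + 1)) := by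
            rw [hgeom, hcG, mul_assoc, ← Real.rpow_add hPpos]
            congr 2
            ring
        _ ≤ √(c j) * G j * ∑ k, 1 / ((d : ℝ) + 1) * (√(X k (j k)))⁻¹ :=
            mul_le_mul_of_nonneg_left hamgm (mul_nonneg (Real.sqrt_nonneg _) (hG0 j))
        _ = _ := by
            rw [Finset.mul_sum]
            exact Finset.sum_congr rfl fun k _ => by ring
  -- both `c` and the product of its marginals have total mass one
  have hsum := Finset.sum_le_sum fun j (_ : j ∈ Finset.univ) => hj j
  rw [Finset.sum_sub_distrib, ← Finset.mul_sum, ← Finset.mul_sum, sum_prod_pi_fin, ha,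
    Finset.sum_comm] at hsum
  simp only [hX1, Finset.prod_const_one, mul_one, add_sub_cancel_right, ← Finset.mul_sum] at hsum
  refine hsum.trans ?_
  calc 1 / ((d : ℝ) + 1) * ∑ k : Fin (d + 1), ∑ j, √(c j) * G j * (√(X k (j k)))⁻¹
      ≤ 1 / ((d : ℝ) + 1) * ∑ k : Fin (d + 1), √2 ^ d * B := by
        gcongr with k _
        exact hk k
    _ = √2 ^ d * B := by
        simp only [Finset.sum_const, Finset.card_univ, Fintype.card_fin, nsmul_eq_mul]
        push_cast
        field_simp

/-- The Hardy–Littlewood/Praciano-Pereira inequality: `p ≥ 2m`, that is `t ≤ 1 / (2m)`, with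
exponent `ρ`, where `1 / ρ = 1 / 2 + 1 / (2m) - t`. -/
theorem FormBound.rpow_sum_le {d : ℕ} {a : (Fin (d + 1) → Fin n) → 𝕜} {t B : ℝ} (ht : 0 ≤ t)
    (htd : t ≤ 1 / (2 * (d + 1))) (h : FormBound a t B) :
    (∑ j, ‖a j‖ ^ (1 / (1 / 2 + 1 / (2 * ((d : ℝ) + 1)) - t)))
      ^ (1 / 2 + 1 / (2 * ((d : ℝ) + 1)) - t) ≤ √2 ^ d * B :=
  rpow_sum_le_of_normalized (by linarith) (by positivity)
    (fun _ _ h1 h2 => one_le_of_sum_rpow_eq_one ht htd h1 h2) h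

/-- The Dimant–Sevilla-Peris inequality: `m < p ≤ 2m`, with exponent `p / (p - m)`. It follows from
the case `p = 2m`, exponent `2`, applied to the array weighted by the marginals of
`‖a‖ ^ (p / (p - m))`. -/
theorem FormBound.rpow_sum_le_of_le {d : ℕ} {a : (Fin (d + 1) → Fin n) → 𝕜} {t B : ℝ}
    (htd : 1 / (2 * ((d : ℝ) + 1)) ≤ t) (ht1 : (d + 1) * t < 1) (h : FormBound a t B) :
    (∑ j, ‖a j‖ ^ (1 / (1 - ((d : ℝ) + 1) * t))) ^ (1 - ((d : ℝ) + 1) * t) ≤ √2 ^ d * B := by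
  have hq : 0 < 1 - ((d : ℝ) + 1) * t := by linarith
  have hd : (0 : ℝ) < d + 1 := by positivity
  refine rpow_sum_le_of_normalized hq (by positivity) (fun a B h ha => ?_) h
  set c : (Fin (d + 1) → Fin n) → ℝ := fun j => ‖a j‖ ^ (1 / (1 - ((d : ℝ) + 1) * t)) with hc
  have hc0 : ∀ j, 0 ≤ c j := fun j => Real.rpow_nonneg (norm_nonneg _) _
  have h2 := (h.weight (s' := 1 / (2 * ((d : ℝ) + 1))) (by positivity) htd
    (marginal_nonneg hc0) fun l => ((sum_marginal c l).trans ha).le).rpow_sum_le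
      (by positivity) le_rfl
  rw [add_sub_cancel_right, one_div_one_div] at h2
  refine le_trans ?_ h2
  refine Real.one_le_rpow ?_ (by norm_num)
  refine ha.symm.le.trans (Finset.sum_le_sum fun j _ => ?_)
  rw [norm_mul, RCLike.norm_ofReal, abs_of_nonneg
      (Finset.prod_nonneg fun l _ => Real.rpow_nonneg (marginal_nonneg hc0 _ _) _)]
  -- every marginal dominates `c`, and this crude bound is all that is needed
  have hprod : c j ^ (((d : ℝ) + 1) * (t - 1 / (2 * ((d : ℝ) + 1))))
      ≤ ∏ l, marginal c l (j l) ^ (t - 1 / (2 * ((d : ℝ) + 1))) := by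
    have : ∏ _l : Fin (d + 1), c j ^ (t - 1 / (2 * ((d : ℝ) + 1)))
        ≤ ∏ l, marginal c l (j l) ^ (t - 1 / (2 * ((d : ℝ) + 1))) :=
      Finset.prod_le_prod (fun l _ => Real.rpow_nonneg (hc0 _) _) fun l _ =>
        Real.rpow_le_rpow (hc0 j) (le_marginal hc0 l j) (sub_nonneg.2 htd)
    refine le_of_eq_of_le ?_ this
    rw [Finset.prod_const, Finset.card_univ, Fintype.card_fin, ← Real.rpow_natCast,
      ← Real.rpow_mul (hc0 j)]
    congr 1
    push_cast
    ring
  calc ‖a j‖ ^ (1 / (1 - ((d : ℝ) + 1) * t))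
      = (‖a j‖ * c j ^ (((d : ℝ) + 1) * (t - 1 / (2 * ((d : ℝ) + 1))))) ^ (2 : ℝ) := by
        rcases (norm_nonneg (a j)).eq_or_lt with h0 | hpos
        · rw [← h0, zero_mul, Real.zero_rpow (by positivity), Real.zero_rpow (by norm_num)]
        · rw [hc]
          simp only
          rw [← Real.rpow_mul hpos.le, mul_comm ‖a j‖, ← Real.rpow_add_one hpos.ne',
            ← Real.rpow_mul hpos.le]
          congr 1
          field_simp
          ring
    _ ≤ _ := by
        refine Real.rpow_le_rpow ?_ (mul_le_mul_of_nonneg_left hprod (norm_nonneg _)) (by norm_num)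
        exact mul_nonneg (norm_nonneg _) (Real.rpow_nonneg (hc0 j) _)

/-- `ℓ_q`-norms decrease in `q`. -/
theorem rpow_sum_rpow_anti {ι : Type*} [Fintype ι] {f : ι → ℝ} (hf : ∀ i, 0 ≤ f i) {q r : ℝ}
    (hq : 0 < q) (hqr : q ≤ r) : (∑ i, f i ^ r) ^ (1 / r) ≤ (∑ i, f i ^ q) ^ (1 / q) := by
  have hr : 0 < r := hq.trans_le hqr
  set S := ∑ i, f i ^ q with hS
  have hS0 : 0 ≤ S := Finset.sum_nonneg fun i _ => Real.rpow_nonneg (hf i) _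
  have hi : ∀ i, f i ^ q ≤ S := fun i =>
    Finset.single_le_sum (f := fun i => f i ^ q) (fun i _ => Real.rpow_nonneg (hf i) _)
      (Finset.mem_univ i)
  have h1 : ∑ i, f i ^ r ≤ S * S ^ ((r - q) / q) := by
    rw [hS, Finset.sum_mul, ← hS]
    refine Finset.sum_le_sum fun i _ => ?_
    calc f i ^ r = f i ^ q * (f i ^ q) ^ ((r - q) / q) := by
          rw [← Real.rpow_mul (hf i), mul_div_cancel₀ _ hq.ne']
          rcases (hf i).eq_or_lt with h0 | hpos
          · rw [← h0, Real.zero_rpow hr.ne', Real.zero_rpow hq.ne', zero_mul]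
          · rw [← Real.rpow_add hpos, add_sub_cancel]
      _ ≤ _ := mul_le_mul_of_nonneg_left
          (Real.rpow_le_rpow (Real.rpow_nonneg (hf i) _) (hi i)
            (div_nonneg (sub_nonneg.2 hqr) hq.le)) (Real.rpow_nonneg (hf i) _)
  rcases hS0.eq_or_lt with h0 | hpos
  · rw [← h0, zero_mul] at h1
    rw [← h0, le_antisymm h1 (Finset.sum_nonneg fun i _ => Real.rpow_nonneg (hf i) _),
      Real.zero_rpow (by positivity), Real.zero_rpow (by positivity)]
  · calc (∑ i, f i ^ r) ^ (1 / r) ≤ (S * S ^ ((r - q) / q)) ^ (1 / r) :=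
          Real.rpow_le_rpow (Finset.sum_nonneg fun i _ => Real.rpow_nonneg (hf i) _) h1
            (by positivity)
      _ = S ^ (1 / q) := by
          nth_rewrite 1 [← Real.rpow_one S]
          rw [← Real.rpow_add hpos, ← Real.rpow_mul hpos.le]
          congr 1
          field_simp
          ring

/-- Hölder's inequality between `ℓ_r`- and `ℓ_q`-norms. -/
theorem rpow_sum_rpow_le_card {ι : Type*} [Fintype ι] {f : ι → ℝ} (hf : ∀ i, 0 ≤ f i) {q r : ℝ}
    (hr : 0 < r) (hrq : r ≤ q) : (∑ i, f i ^ r) ^ (1 / r)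
      ≤ (Fintype.card ι : ℝ) ^ (1 / r - 1 / q) * (∑ i, f i ^ q) ^ (1 / q) := by
  have hq : 0 < q := hr.trans_le hrq
  have h := Real.rpow_sum_le_const_mul_sum_rpow Finset.univ (fun i => f i ^ r)
    ((one_le_div hr).2 hrq)
  have habs : ∀ i, |f i ^ r| = f i ^ r := fun i => abs_of_nonneg (Real.rpow_nonneg (hf i) _)
  have hpw : ∀ i, (f i ^ r) ^ (q / r) = f i ^ q := fun i => by
    rw [← Real.rpow_mul (hf i), mul_div_cancel₀ _ hr.ne']
  simp only [habs, hpw, Finset.card_univ] at h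
  have hS0 : 0 ≤ ∑ i, f i ^ r := Finset.sum_nonneg fun i _ => Real.rpow_nonneg (hf i) _
  have hC : (0 : ℝ) ≤ (Fintype.card ι : ℝ) := by positivity
  have h2 := Real.rpow_le_rpow (Real.rpow_nonneg hS0 _) h (by positivity : 0 ≤ 1 / q)
  rw [← Real.rpow_mul hS0, Real.mul_rpow (Real.rpow_nonneg hC _)
    (Finset.sum_nonneg fun i _ => Real.rpow_nonneg (hf i) _), ← Real.rpow_mul hC] at h2
  have e1 : q / r * (1 / q) = 1 / r := by field_simp
  have e2 : (q / r - 1) * (1 / q) = 1 / r - 1 / q := by field_simp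
  rwa [e1, e2] at h2

/-- The estimate for `p ≥ 2m` and all `r`: Hölder's inequality for `r ≤ ρ`, monotonicity of the
`ℓ_r`-norms for `r ≥ ρ`. -/
theorem FormBound.rpow_sum_le_max {d : ℕ} {a : (Fin (d + 1) → Fin n) → 𝕜} {t B r : ℝ}
    (hn : 0 < n) (hr : 0 < r) (ht : 0 ≤ t) (htd : t ≤ 1 / (2 * (d + 1))) (h : FormBound a t B) :
    (∑ j, ‖a j‖ ^ r) ^ (1 / r)
      ≤ √2 ^ d * (n : ℝ) ^ max ((d + 1) * (1 / r + t - 1 / 2) - 1 / 2) 0 * B := by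
  set q := 1 / 2 + 1 / (2 * ((d : ℝ) + 1)) - t with hq
  have hq0 : 0 < q := by rw [hq]; linarith
  have hd : (0 : ℝ) < d + 1 := by positivity
  have hn1 : (1 : ℝ) ≤ n := by exact_mod_cast hn
  have hmain := h.rpow_sum_le ht htd
  rw [← hq] at hmain
  have hB := h.nonneg
  have hq' : 1 / (1 / q) = q := one_div_one_div q
  rcases le_total r (1 / q) with hle | hle
  · have h1 := rpow_sum_rpow_le_card (fun j => norm_nonneg (a j)) hr hle
    rw [hq'] at h1
    refine h1.trans ((mul_le_mul_of_nonneg_left hmain (by positivity)).trans ?_)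
    have : (Fintype.card (Fin (d + 1) → Fin n) : ℝ) ^ (1 / r - q)
        ≤ (n : ℝ) ^ max ((d + 1) * (1 / r + t - 1 / 2) - 1 / 2) 0 := by
      rw [Fintype.card_fun, Fintype.card_fin, Fintype.card_fin]
      push_cast
      rw [← Real.rpow_natCast, ← Real.rpow_mul (by positivity)]
      refine Real.rpow_le_rpow_of_exponent_le hn1 (le_trans (le_of_eq ?_) (le_max_left _ _))
      rw [hq]
      push_cast
      field_simp
      ring
    calc _ = (Fintype.card (Fin (d + 1) → Fin n) : ℝ) ^ (1 / r - q) * (√2 ^ d * B) := rfl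
      _ ≤ (n : ℝ) ^ max ((d + 1) * (1 / r + t - 1 / 2) - 1 / 2) 0 * (√2 ^ d * B) := by gcongr
      _ = _ := by ring
  · have h1 := rpow_sum_rpow_anti (fun j => norm_nonneg (a j)) (by positivity) hle
    rw [hq'] at h1
    refine h1.trans (hmain.trans ?_)
    have : (1 : ℝ) ≤ (n : ℝ) ^ max ((d + 1) * (1 / r + t - 1 / 2) - 1 / 2) 0 :=
      Real.one_le_rpow hn1 (le_max_right _ _)
    calc √2 ^ d * B = √2 ^ d * 1 * B := by ring
      _ ≤ _ := by gcongr

/-- For `p < 2m` and `r ≤ 2` the estimate is deduced from the case `p = 2m`. -/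
theorem FormBound.rpow_sum_le_max_of_le_two {d : ℕ} {a : (Fin (d + 1) → Fin n) → 𝕜} {t B r : ℝ}
    (hn : 0 < n) (hr : 0 < r) (hr2 : r ≤ 2) (htd : 1 / (2 * ((d : ℝ) + 1)) ≤ t)
    (h : FormBound a t B) :
    (∑ j, ‖a j‖ ^ r) ^ (1 / r)
      ≤ √2 ^ d * (n : ℝ) ^ max ((d + 1) * (1 / r + t - 1 / 2) - 1 / 2) 0 * B := by
  have hd : (0 : ℝ) < d + 1 := by positivity
  have hn1 : (1 : ℝ) ≤ n := by exact_mod_cast hn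
  have h1 := (h.mono_exponent hn (s' := 1 / (2 * ((d : ℝ) + 1))) (by positivity)
    htd).rpow_sum_le_max hn hr (by positivity) le_rfl
  refine h1.trans ?_
  rw [mul_assoc, ← mul_assoc ((n : ℝ) ^ _) ((n : ℝ) ^ _), ← Real.rpow_add (by positivity),
    ← mul_assoc]
  have hB := h.nonneg
  gcongr
  · have hr' : 1 / 2 ≤ 1 / r := one_div_le_one_div_of_le hr hr2
    have e : ((d : ℝ) + 1) * (1 / r + 1 / (2 * ((d : ℝ) + 1)) - 1 / 2) - 1 / 2
        = (d + 1) * (1 / r - 1 / 2) := by field_simp; ring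
    have h0 : 0 ≤ ((d : ℝ) + 1) * (1 / r - 1 / 2) := mul_nonneg hd.le (by linarith)
    rw [e, max_eq_left h0]
    refine le_trans (le_of_eq ?_) (le_max_left _ _)
    push_cast
    field_simp
    ring

/-- The upper estimate for `m < p ≤ 2m` and `r ≥ 2`. If `r` is smaller than `p / (p - m)`, then `p`
is replaced by the larger `q` for which `r = q / (q - m)`. -/
theorem FormBound.rpow_sum_le_max_of_two_le {d : ℕ} {a : (Fin (d + 1) → Fin n) → 𝕜} {t B r : ℝ}
    (hn : 0 < n) (hr : 2 ≤ r) (htd : 1 / (2 * ((d : ℝ) + 1)) ≤ t) (ht1 : (d + 1) * t < 1)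
    (h : FormBound a t B) :
    (∑ j, ‖a j‖ ^ r) ^ (1 / r)
      ≤ √2 ^ d * (n : ℝ) ^ max (1 / r + (d + 1) * t - 1) 0 * B := by
  have hd : (0 : ℝ) < d + 1 := by positivity
  have hn1 : (1 : ℝ) ≤ n := by exact_mod_cast hn
  have hr0 : 0 < r := by linarith
  have hB := h.nonneg
  have hq0 : 0 < 1 - ((d : ℝ) + 1) * t := by linarith
  rcases le_total (1 / r) (1 - ((d : ℝ) + 1) * t) with hle | hle
  · have hle' : 1 / (1 - ((d : ℝ) + 1) * t) ≤ r := by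
      rw [div_le_iff₀ hr0] at hle
      rw [div_le_iff₀ hq0]
      linarith
    have h1 := rpow_sum_rpow_anti (fun j => norm_nonneg (a j)) (by positivity) hle'
    rw [one_div_one_div] at h1
    refine h1.trans ((h.rpow_sum_le_of_le htd ht1).trans ?_)
    have : (1 : ℝ) ≤ (n : ℝ) ^ max (1 / r + (d + 1) * t - 1) 0 :=
      Real.one_le_rpow hn1 (le_max_right _ _)
    calc √2 ^ d * B = √2 ^ d * 1 * B := by ring
      _ ≤ _ := by gcongr
  · have hr' : 1 / r ≤ 1 / 2 := one_div_le_one_div_of_le (by norm_num) hr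
    have hrpos : 0 < 1 / r := by positivity
    have hs1 : 1 / (2 * ((d : ℝ) + 1)) ≤ (1 - 1 / r) / (d + 1) := by
      rw [← div_div]
      gcongr
      linarith
    have hs2 : (1 - 1 / r) / (d + 1) ≤ t := by
      rw [div_le_iff₀ hd]
      linarith
    have e : ((d : ℝ) + 1) * ((1 - 1 / r) / (d + 1)) = 1 - 1 / r := mul_div_cancel₀ _ hd.ne'
    have h1 := (h.mono_exponent hn (le_trans (by positivity) hs1) hs2).rpow_sum_le_of_le hs1
      (by rw [e]; linarith)
    rw [e, sub_sub_cancel, one_div_one_div] at h1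
    refine h1.trans ?_
    rw [← mul_assoc]
    gcongr
    · refine le_trans (le_of_eq ?_) (le_max_left _ _)
      push_cast
      field_simp
      ring

end

/-! ### Random signs -/

section
variable {𝕜 : Type*} [RCLike 𝕜] {m n : ℕ}

/-- Exponential moments of Rademacher sums. -/
theorem sum_exp_sign_sum_le {ι : Type*} [Fintype ι] [DecidableEq ι] (y : ι → ℝ) :
    ∑ ε : ι → Bool, Real.exp (∑ j, boolSign ℝ (ε j) * y j)
      ≤ 2 ^ Fintype.card ι * Real.exp ((∑ j, y j ^ 2) / 2) := by
  have h1 : ∑ ε : ι → Bool, Real.exp (∑ j, boolSign ℝ (ε j) * y j)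
      = ∏ j, (2 * Real.cosh (y j)) := by
    have : ∀ j, 2 * Real.cosh (y j) = ∑ b : Bool, Real.exp (boolSign ℝ b * y j) := fun j => by
      simp only [boolSign, Fintype.sum_bool, Real.cosh_eq, if_true, Bool.false_eq_true, if_false,
        one_mul, neg_one_mul]
      ring
    simp only [this, Finset.prod_univ_sum, Fintype.piFinset_univ, Real.exp_sum]
  rw [h1, Finset.prod_mul_distrib, Finset.prod_const, Finset.card_univ, Finset.sum_div,
    Real.exp_sum]
  exact mul_le_mul_of_nonneg_left (Finset.prod_le_prod (fun _ _ => (Real.cosh_pos _).le)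
    fun j _ => Real.cosh_le_exp_half_sq _) (by positivity)

/-- A choice of signs that is good for finitely many vectors of the Euclidean unit ball, by the
exponential moment bound and a union bound. -/
theorem exists_signs_abs_sum_le {ι κ : Type*} [Fintype ι] [DecidableEq ι] (N : Finset κ)
    (y : κ → ι → ℝ) (hy : ∀ g ∈ N, ∑ j, y g j ^ 2 ≤ 1) {t : ℝ} (ht : 0 ≤ t)
    (hN : 2 * (N.card : ℝ) < Real.exp (t ^ 2 / 2)) :
    ∃ ε : ι → Bool, ∀ g ∈ N, |∑ j, boolSign ℝ (ε j) * y g j| ≤ t := by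
  by_contra! hcon
  -- if every choice fails, one of the two exponentials with parameters `±t` reaches `exp (t ^ 2)`
  have hlow : ∀ ε : ι → Bool, Real.exp (t ^ 2) ≤ ∑ g ∈ N,
      (Real.exp (∑ j, boolSign ℝ (ε j) * (t * y g j))
        + Real.exp (∑ j, boolSign ℝ (ε j) * (-t * y g j))) := by
    intro ε
    obtain ⟨g, hg, hgt⟩ := hcon ε
    refine le_trans ?_ (Finset.single_le_sum (f := fun g =>
      Real.exp (∑ j, boolSign ℝ (ε j) * (t * y g j))
        + Real.exp (∑ j, boolSign ℝ (ε j) * (-t * y g j))) (fun _ _ => by positivity) hg)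
    have e1 : ∀ s : ℝ, ∑ j, boolSign ℝ (ε j) * (s * y g j)
        = s * ∑ j, boolSign ℝ (ε j) * y g j := fun s => by
      rw [Finset.mul_sum]
      exact Finset.sum_congr rfl fun j _ => by ring
    simp only [e1]
    rcases lt_abs.1 hgt with h | h
    · have : Real.exp (t ^ 2) ≤ Real.exp (t * ∑ j, boolSign ℝ (ε j) * y g j) :=
        Real.exp_le_exp.2 (by nlinarith)
      linarith [Real.exp_pos (-t * ∑ j, boolSign ℝ (ε j) * y g j)]
    · have : Real.exp (t ^ 2) ≤ Real.exp (-t * ∑ j, boolSign ℝ (ε j) * y g j) :=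
        Real.exp_le_exp.2 (by nlinarith)
      linarith [Real.exp_pos (t * ∑ j, boolSign ℝ (ε j) * y g j)]
  have hmom : ∀ g ∈ N, ∀ s : ℝ, s ^ 2 = t ^ 2 →
      ∑ ε : ι → Bool, Real.exp (∑ j, boolSign ℝ (ε j) * (s * y g j))
        ≤ 2 ^ Fintype.card ι * Real.exp (t ^ 2 / 2) := by
    intro g hg s hs
    refine (sum_exp_sign_sum_le _).trans (mul_le_mul_of_nonneg_left (Real.exp_le_exp.2 ?_)
      (by positivity))
    simp only [mul_pow, hs, ← Finset.mul_sum]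
    nlinarith [hy g hg, sq_nonneg t]
  have hsum := Finset.sum_le_sum fun ε (_ : ε ∈ Finset.univ) => hlow ε
  rw [Finset.sum_comm] at hsum
  have hup : ∑ g ∈ N, ∑ ε : ι → Bool, (Real.exp (∑ j, boolSign ℝ (ε j) * (t * y g j))
        + Real.exp (∑ j, boolSign ℝ (ε j) * (-t * y g j)))
      ≤ ∑ g ∈ N, 2 * (2 ^ Fintype.card ι * Real.exp (t ^ 2 / 2)) := by
    refine Finset.sum_le_sum fun g hg => ?_
    rw [Finset.sum_add_distrib, two_mul]
    exact add_le_add (hmom g hg t rfl) (hmom g hg (-t) (neg_sq t))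
  have h3 := hsum.trans hup
  simp only [Finset.sum_const, Finset.card_univ, Fintype.card_pi, Fintype.card_bool,
    Finset.prod_const, nsmul_eq_mul] at h3
  push_cast at h3
  have e2 : Real.exp (t ^ 2) = Real.exp (t ^ 2 / 2) * Real.exp (t ^ 2 / 2) := by
    rw [← Real.exp_add, add_halves]
  have hc : (0 : ℝ) < 2 ^ Fintype.card ι * Real.exp (t ^ 2 / 2) := by positivity
  rw [e2] at h3
  nlinarith

/-- The grid points `k / n`, `-n ≤ k ≤ n`. -/
noncomputable def gridPoint (n : ℕ) (k : Fin (2 * n + 1)) : ℝ := ((k : ℝ) - n) / n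

/-- Rounding towards zero: it keeps the Euclidean unit ball invariant. -/
theorem exists_gridPoint_near (hn : 0 < n) {u : ℝ} (hu : |u| ≤ 1) :
    ∃ k, |gridPoint n k| ≤ |u| ∧ |u - gridPoint n k| ≤ 1 / n := by
  have hn' : (0 : ℝ) < n := by exact_mod_cast hn
  suffices h : ∃ z : ℤ, |(z : ℝ)| ≤ n * |u| ∧ |n * u - z| ≤ 1 by
    obtain ⟨z, hz1, hz2⟩ := h
    have hzn : |(z : ℝ)| ≤ n := hz1.trans (by nlinarith)
    have hzn' : |z| ≤ n := by exact_mod_cast hzn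
    have hb := abs_le.1 hzn'
    have hkey : gridPoint n ⟨(z + n).toNat, by omega⟩ = z / n := by
      have : (((z + n).toNat : ℤ) : ℝ) = z + n := by
        rw [Int.toNat_of_nonneg (by omega)]
        push_cast
        rfl
      simp only [gridPoint]
      rw [← Int.cast_natCast (R := ℝ) (z + n).toNat, this, add_sub_cancel_right]
    refine ⟨⟨(z + n).toNat, by omega⟩, ?_, ?_⟩
    · rw [hkey, abs_div, abs_of_pos hn', div_le_iff₀ hn', mul_comm]
      exact hz1
    · have : u - z / n = (n * u - z) / n := by field_simp
      rw [hkey, this, abs_div, abs_of_pos hn']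
      gcongr
  rcases le_total 0 u with h0 | h0
  · have hf := Int.floor_le ((n : ℝ) * u)
    have hf0 : (0 : ℝ) ≤ ⌊(n : ℝ) * u⌋ := by
      exact_mod_cast Int.floor_nonneg.2 (mul_nonneg hn'.le h0)
    refine ⟨⌊(n : ℝ) * u⌋, ?_, ?_⟩
    · rwa [abs_of_nonneg hf0, abs_of_nonneg h0]
    · rw [abs_of_nonneg (by linarith)]
      linarith [Int.lt_floor_add_one ((n : ℝ) * u)]
  · have hf := Int.le_ceil ((n : ℝ) * u)
    have hf0 : (⌈(n : ℝ) * u⌉ : ℝ) ≤ 0 := by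
      exact_mod_cast Int.ceil_le.2 (by push_cast; nlinarith)
    refine ⟨⌈(n : ℝ) * u⌉, ?_, ?_⟩
    · rw [abs_of_nonpos hf0, abs_of_nonpos h0]
      linarith
    · rw [abs_of_nonpos (by linarith)]
      linarith [Int.ceil_lt_add_one ((n : ℝ) * u)]

theorem norm_sum_mul_le_sqrt {ι : Type*} [Fintype ι] (φ x : ι → 𝕜) :
    ‖∑ i, φ i * x i‖ ≤ √(∑ i, ‖φ i‖ ^ 2) * √(∑ i, ‖x i‖ ^ 2) := by
  refine (norm_sum_le _ _).trans ?_
  simp only [norm_mul]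
  exact Real.sum_mul_le_sqrt_mul_sqrt _ _ _

/-- A linear functional is controlled on the unit ball of `ℓ_2^n` by its values on grid points. -/
theorem norm_sum_mul_le_of_grid (hn : 16 ≤ n) (φ : Fin n → 𝕜) {M : ℝ}
    (hM : ∀ g : Fin n → Fin (2 * n + 1), ∑ i, gridPoint n (g i) ^ 2 ≤ 1 →
      ‖∑ i, φ i * (gridPoint n (g i) : 𝕜)‖ ≤ M)
    (x : Fin n → 𝕜) (hx : ∑ i, ‖x i‖ ^ 2 ≤ 1) : ‖∑ i, φ i * x i‖ ≤ 4 * M := by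
  have hn' : (0 : ℝ) < n := by
    have : 0 < n := by omega
    exact_mod_cast this
  set Φ := √(∑ i, ‖φ i‖ ^ 2) with hΦ
  have hΦ0 : 0 ≤ Φ := Real.sqrt_nonneg _
  have hΦsq : Φ ^ 2 = ∑ i, ‖φ i‖ ^ 2 :=
    Real.sq_sqrt (Finset.sum_nonneg fun _ _ => by positivity)
  -- rounding changes a real vector by at most `1 / √n ≤ 1 / 4` in the Euclidean norm
  have hreal : ∀ u : Fin n → ℝ, ∑ i, u i ^ 2 ≤ 1 → ‖∑ i, φ i * (u i : 𝕜)‖ ≤ M + Φ / 4 := by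
    intro u hu
    have hu1 : ∀ i, |u i| ≤ 1 := fun i => by
      rw [← sq_le_one_iff_abs_le_one]
      exact (Finset.single_le_sum (f := fun i => u i ^ 2) (fun i _ => sq_nonneg _)
        (Finset.mem_univ i)).trans hu
    choose g hg1 hg2 using fun i => exists_gridPoint_near (by omega : 0 < n) (hu1 i)
    have hgM := hM g ((Finset.sum_le_sum fun i _ => sq_le_sq.2 (hg1 i)).trans hu)
    have hdiff : ‖∑ i, φ i * ((u i - gridPoint n (g i) : ℝ) : 𝕜)‖ ≤ Φ / 4 := by
      refine (norm_sum_mul_le_sqrt _ _).trans ?_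
      rw [← hΦ, div_eq_mul_inv]
      refine mul_le_mul_of_nonneg_left ?_ hΦ0
      rw [Real.sqrt_le_left (by norm_num)]
      calc ∑ i, ‖((u i - gridPoint n (g i) : ℝ) : 𝕜)‖ ^ 2 ≤ ∑ _i : Fin n, (1 / (n : ℝ)) ^ 2 := by
            refine Finset.sum_le_sum fun i _ => ?_
            rw [RCLike.norm_ofReal]
            exact pow_le_pow_left₀ (abs_nonneg _) (hg2 i) 2
        _ = 1 / n := by
            simp only [Finset.sum_const, Finset.card_univ, Fintype.card_fin, nsmul_eq_mul]
            field_simp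
        _ ≤ 1 / 16 := one_div_le_one_div_of_le (by norm_num) (by exact_mod_cast hn)
        _ = (4⁻¹ : ℝ) ^ 2 := by norm_num
    have hsplit : ∑ i, φ i * (u i : 𝕜) = ∑ i, φ i * (gridPoint n (g i) : 𝕜)
        + ∑ i, φ i * ((u i - gridPoint n (g i) : ℝ) : 𝕜) := by
      rw [← Finset.sum_add_distrib]
      refine Finset.sum_congr rfl fun i _ => ?_
      push_cast
      ring
    rw [hsplit]
    exact (norm_add_le _ _).trans (add_le_add hgM hdiff)
  -- real and imaginary parts are treated separately
  have hcomplex : ∀ z : Fin n → 𝕜, ∑ i, ‖z i‖ ^ 2 ≤ 1 → ‖∑ i, φ i * z i‖ ≤ 2 * M + Φ / 2 := by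
    intro z hz
    have hsplit : ∑ i, φ i * z i = ∑ i, φ i * (RCLike.re (z i) : 𝕜)
        + (∑ i, φ i * (RCLike.im (z i) : 𝕜)) * RCLike.I := by
      rw [Finset.sum_mul, ← Finset.sum_add_distrib]
      refine Finset.sum_congr rfl fun i _ => ?_
      nth_rewrite 1 [← RCLike.re_add_im (z i)]
      ring
    have hre := hreal (fun i => RCLike.re (z i)) ((Finset.sum_le_sum fun i _ =>
      sq_le_sq.2 (by rw [abs_of_nonneg (norm_nonneg _)]; exact RCLike.abs_re_le_norm _)).trans hz)
    have him := hreal (fun i => RCLike.im (z i)) ((Finset.sum_le_sum fun i _ =>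
      sq_le_sq.2 (by rw [abs_of_nonneg (norm_nonneg _)]; exact RCLike.abs_im_le_norm _)).trans hz)
    have hI : ‖(RCLike.I : 𝕜)‖ ≤ 1 := by
      rcases eq_or_ne (RCLike.I : 𝕜) 0 with h | h
      · simp [h]
      · exact (RCLike.norm_I_of_ne_zero h).le
    rw [hsplit]
    refine (norm_add_le _ _).trans ?_
    rw [norm_mul]
    have := mul_le_mul_of_nonneg_left hI
      (norm_nonneg (∑ i, φ i * (RCLike.im (z i) : 𝕜)))
    linarith
  -- testing on the normalized conjugate of `φ` gives `Φ ≤ 2 * M + Φ / 2`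
  have hΦM : Φ ≤ 4 * M := by
    rcases hΦ0.eq_or_lt with h0 | hpos
    · rw [← h0]
      have := hM (fun _ => ⟨n, by omega⟩) (by simp [gridPoint])
      linarith [norm_nonneg (∑ i, φ i * (gridPoint n ⟨n, by omega⟩ : 𝕜))]
    · have h1 := hcomplex (fun i => ((Φ⁻¹ : ℝ) : 𝕜) * (starRingEnd 𝕜) (φ i)) (by
        simp only [norm_mul, RCLike.norm_ofReal, RCLike.norm_conj, mul_pow, sq_abs,
          ← Finset.mul_sum, ← hΦsq]
        rw [← mul_pow, inv_mul_cancel₀ hpos.ne', one_pow])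
      have h2 : ∑ i, φ i * (((Φ⁻¹ : ℝ) : 𝕜) * (starRingEnd 𝕜) (φ i)) = ((Φ : ℝ) : 𝕜) := by
        have : ∀ i, φ i * (((Φ⁻¹ : ℝ) : 𝕜) * (starRingEnd 𝕜) (φ i))
            = ((Φ⁻¹ * ‖φ i‖ ^ 2 : ℝ) : 𝕜) := fun i => by
          rw [mul_left_comm, RCLike.mul_conj]
          push_cast
          rfl
        simp only [this]
        rw [← RCLike.ofReal_sum, ← Finset.mul_sum, ← hΦsq, sq, inv_mul_cancel_left₀ hpos.ne']
      rw [h2, RCLike.norm_ofReal, abs_of_pos hpos] at h1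
      linarith
  calc ‖∑ i, φ i * x i‖ ≤ Φ * √(∑ i, ‖x i‖ ^ 2) := norm_sum_mul_le_sqrt _ _
    _ ≤ Φ * 1 := mul_le_mul_of_nonneg_left (by rw [Real.sqrt_le_one]; exact hx) hΦ0
    _ ≤ 4 * M := by linarith

theorem sum_mul_prod_update (a : (Fin m → Fin n) → 𝕜) (x : Fin m → Fin n → 𝕜) (k : Fin m)
    (u : Fin n → 𝕜) : ∑ j, a j * ∏ l, Function.update x k u l (j l)
      = ∑ i, (∑ j with j k = i, a j * ∏ l ∈ Finset.univ.erase k, x l (j l)) * u i := by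
  rw [← Finset.sum_fiberwise _ (fun j => j k)]
  refine Finset.sum_congr rfl fun i _ => ?_
  rw [Finset.sum_mul]
  refine Finset.sum_congr rfl fun j hj => ?_
  rw [← Finset.mul_prod_erase _ _ (Finset.mem_univ k), Function.update_self,
    (Finset.mem_filter.1 hj).2, mul_right_comm, mul_assoc]
  congr 2
  exact Finset.prod_congr rfl fun l hl => by
    rw [Function.update_of_ne (Finset.ne_of_mem_erase hl)]

/-- The passage from grid points to the unit ball of `ℓ_2^n`, one variable at a time. -/
theorem norm_form_le_of_grid (hn : 16 ≤ n) (a : (Fin m → Fin n) → 𝕜) {M : ℝ}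
    (hM : ∀ g : Fin m → Fin n → Fin (2 * n + 1), (∀ l, ∑ i, gridPoint n (g l i) ^ 2 ≤ 1) →
      ‖∑ j, a j * ∏ l, (gridPoint n (g l (j l)) : 𝕜)‖ ≤ M)
    (x : Fin m → Fin n → 𝕜) (hx : ∀ l, ∑ i, ‖x l i‖ ^ 2 ≤ 1) :
    ‖∑ j, a j * ∏ l, x l (j l)‖ ≤ 4 ^ m * M := by
  suffices h : ∀ (S : Finset (Fin m)) (x : Fin m → Fin n → 𝕜),
      (∀ l ∈ S, ∑ i, ‖x l i‖ ^ 2 ≤ 1) →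
      (∀ l ∉ S, ∃ g : Fin n → Fin (2 * n + 1), ∑ i, gridPoint n (g i) ^ 2 ≤ 1 ∧
        x l = fun i => (gridPoint n (g i) : 𝕜)) →
      ‖∑ j, a j * ∏ l, x l (j l)‖ ≤ 4 ^ S.card * M by
    simpa using h Finset.univ x (fun l _ => hx l) (by simp)
  intro S
  induction S using Finset.induction_on with
  | empty =>
    intro x _ hx
    choose g hg1 hg2 using fun l => hx l (Finset.notMem_empty l)
    simpa [hg2] using hM g hg1
  | insert k S hk ih =>
    intro x hx hg
    have hupd := sum_mul_prod_update a x k (x k)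
    rw [Function.update_eq_self] at hupd
    rw [hupd, Finset.card_insert_of_notMem hk, pow_succ', mul_assoc]
    refine norm_sum_mul_le_of_grid hn _ (fun g hg1 => ?_) (x k)
      (hx k (Finset.mem_insert_self k S))
    rw [← sum_mul_prod_update a x k fun i => (gridPoint n (g i) : 𝕜)]
    refine ih _ (fun l hl => ?_) (fun l hl => ?_)
    · have hne : l ≠ k := fun h => hk (h ▸ hl)
      rw [Function.update_of_ne hne]
      exact hx l (Finset.mem_insert_of_mem hl)
    · by_cases hlk : l = k
      · subst hlk
        exact ⟨g, hg1, Function.update_self _ _ _⟩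
      · rw [Function.update_of_ne hlk]
        exact hg l (by simp [hlk, hl])

/-- Kahane–Salem–Zygmund: some array of signs has norm at most of order `√(n log n)` as a form on
`ℓ_2^n`. -/
theorem exists_sign_formBound (hm : 0 < m) (hn : 16 ≤ n) :
    ∃ ε : (Fin m → Fin n) → Bool, FormBound (fun j => boolSign 𝕜 (ε j)) (1 / 2)
      (4 ^ m * (2 * √(n * m * Real.log (2 * n + 1)))) := by
  have hlog : 0 ≤ Real.log (2 * n + 1) := Real.log_nonneg (by linarith [n.cast_nonneg (α := ℝ)])
  obtain ⟨ε, hε⟩ := exists_signs_abs_sum_le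
    (Finset.univ.filter fun g : Fin m → Fin n → Fin (2 * n + 1) =>
      ∀ l, ∑ i, gridPoint n (g l i) ^ 2 ≤ 1)
    (fun g (j : Fin m → Fin n) => ∏ l, gridPoint n (g l (j l)))
    (fun g hg => by
      simp only [← Finset.prod_pow]
      rw [sum_prod_pi_fin fun l i => gridPoint n (g l i) ^ 2]
      exact Finset.prod_le_one (fun l _ => Finset.sum_nonneg fun i _ => sq_nonneg _)
        fun l _ => (Finset.mem_filter.1 hg).2 l)
    (t := 2 * √(n * m * Real.log (2 * n + 1))) (by positivity)
    (by
      have hcard : ((Finset.univ.filter fun g : Fin m → Fin n → Fin (2 * n + 1) =>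
          ∀ l, ∑ i, gridPoint n (g l i) ^ 2 ≤ 1).card : ℝ) ≤ (2 * n + 1) ^ (n * m) := by
        have h1 := Finset.card_filter_le (Finset.univ : Finset (Fin m → Fin n → Fin (2 * n + 1)))
          fun g => ∀ l, ∑ i, gridPoint n (g l i) ^ 2 ≤ 1
        simp only [Finset.card_univ, Fintype.card_pi, Fintype.card_fin, Finset.prod_const,
          ← pow_mul] at h1
        exact_mod_cast h1
      have hexp : Real.exp ((2 * √(n * m * Real.log (2 * n + 1))) ^ 2 / 2)
          = (2 * n + 1) ^ (n * m) * (2 * n + 1) ^ (n * m) := by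
        rw [mul_pow, Real.sq_sqrt (by positivity), ← pow_add]
        nth_rewrite 2 [← Real.exp_log (by positivity : (0 : ℝ) < 2 * n + 1)]
        rw [← Real.exp_nat_mul]
        congr 1
        push_cast
        ring
      have hbig : (2 : ℝ) < (2 * n + 1) ^ (n * m) := by
        have h16 : (16 : ℝ) ≤ n := by exact_mod_cast hn
        calc (2 : ℝ) < 2 * n + 1 := by linarith
          _ ≤ _ := le_self_pow₀ (by linarith) (Nat.mul_ne_zero (by omega) hm.ne')
      rw [hexp]
      have : (0 : ℝ) < (2 * n + 1) ^ (n * m) := by positivity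
      nlinarith)
  refine ⟨ε, fun w y hw hw1 hy => norm_form_le_of_grid hn _ (fun g hg => ?_) y fun l => ?_⟩
  · have h1 := hε g (by simpa using hg)
    have h2 : ∑ j, boolSign 𝕜 (ε j) * ∏ l, (gridPoint n (g l (j l)) : 𝕜)
        = ((∑ j, boolSign ℝ (ε j) * ∏ l, gridPoint n (g l (j l)) : ℝ) : 𝕜) := by
      push_cast
      refine Finset.sum_congr rfl fun j _ => ?_
      congr 1
      cases ε j <;> simp [boolSign]
    rwa [h2, RCLike.norm_ofReal]
  · refine (Finset.sum_le_sum fun i _ => ?_).trans (hw1 l)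
    have := pow_le_pow_left₀ (norm_nonneg _) (hy l i) 2
    rwa [← Real.sqrt_eq_rpow, Real.sq_sqrt (hw l i)] at this

/-! ### Further extremal arrays -/

theorem sum_filter_diagonal {M : Type*} [AddCommMonoid M] (hm : 0 < m)
    (F : (Fin m → Fin n) → M) :
    ∑ j : Fin m → Fin n with ∃ i, ∀ l, j l = i, F j = ∑ i, F fun _ => i := by
  symm
  refine Finset.sum_bij (fun i _ _ => i) (fun i _ => ?_) (fun i _ i' _ h => ?_) (fun j hj => ?_)
    (fun _ _ => rfl)
  · exact Finset.mem_filter.2 ⟨Finset.mem_univ _, i, fun _ => rfl⟩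
  · exact congrFun h ⟨0, hm⟩
  · obtain ⟨i, hi⟩ := (Finset.mem_filter.1 hj).2
    exact ⟨i, Finset.mem_univ i, funext fun l => (hi l).symm⟩

/-- The diagonal form `∑ᵢ x¹ᵢ ⋯ xᵐᵢ` has norm at most one on `ℓ_m^n`. -/
theorem formBound_diagonal (hm : 0 < m) :
    FormBound (fun j : Fin m → Fin n => if ∃ i, ∀ l, j l = i then (1 : 𝕜) else 0) (1 / m) 1 := by
  intro w y hw hw1 hy
  have hm' : (0 : ℝ) < m := by exact_mod_cast hm
  have hdiag : ∑ j : Fin m → Fin n, (if ∃ i, ∀ l, j l = i then (1 : 𝕜) else 0) * ∏ l, y l (j l)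
      = ∑ i, ∏ l, y l i := by
    simp only [ite_mul, one_mul, zero_mul]
    rw [← Finset.sum_filter, sum_filter_diagonal hm]
  rw [hdiag]
  calc ‖∑ i, ∏ l, y l i‖ ≤ ∑ i, ∏ l, ‖y l i‖ :=
        (norm_sum_le _ _).trans (Finset.sum_le_sum fun i _ => (norm_prod _ _).le)
    _ ≤ ∑ i, ∏ l, w l i ^ (1 / (m : ℝ)) := Finset.sum_le_sum fun i _ =>
        Finset.prod_le_prod (fun _ _ => norm_nonneg _) fun l _ => hy l i
    _ ≤ ∑ i, ∑ l, 1 / (m : ℝ) * w l i := Finset.sum_le_sum fun i _ =>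
        Real.geom_mean_le_arith_mean_weighted Finset.univ (fun _ => 1 / (m : ℝ))
          (fun l => w l i) (fun _ _ => by positivity) (by simp [hm'.ne']) fun l _ => hw l i
    _ = 1 / m * ∑ l, ∑ i, w l i := by
        rw [Finset.sum_comm]
        simp only [Finset.mul_sum]
    _ ≤ 1 / m * ∑ _l : Fin m, 1 := by
        gcongr with l _
        exact hw1 l
    _ = 1 := by simp [hm'.ne']

theorem sum_norm_diagonal_rpow (hm : 0 < m) {r : ℝ} (hr : 0 < r) :
    ∑ j : Fin m → Fin n, ‖(if ∃ i, ∀ l, j l = i then (1 : 𝕜) else 0)‖ ^ r = n := by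
  have : ∀ j : Fin m → Fin n, ‖(if ∃ i, ∀ l, j l = i then (1 : 𝕜) else 0)‖ ^ r
      = if ∃ i, ∀ l, j l = i then 1 else 0 := fun j => by
    split_ifs <;> simp [hr.ne']
  simp only [this]
  rw [← Finset.sum_filter, sum_filter_diagonal hm]
  simp

theorem formBound_single (j₀ : Fin m → Fin n) {t : ℝ} (ht : 0 ≤ t) :
    FormBound (Pi.single j₀ (1 : 𝕜)) t 1 := by
  intro w y hw hw1 hy
  rw [Finset.sum_eq_single j₀ (fun j _ hj => by simp [hj]) (by simp)]
  rw [Pi.single_eq_same, one_mul, norm_prod]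
  refine Finset.prod_le_one (fun _ _ => norm_nonneg _) fun l _ => (hy l _).trans ?_
  exact Real.rpow_le_one (hw l _) ((Finset.single_le_sum (f := w l) (fun i _ => hw l i)
    (Finset.mem_univ _)).trans (hw1 l)) ht

end

/-! ### Multilinear forms on `ℓ_p^n` and their coefficient arrays -/

section
variable {𝕜 : Type*} [RCLike 𝕜] {m n : ℕ} {p : ℝ≥0∞} [Fact (1 ≤ p)]

theorem toReal_pos_of_ne_top (hp : p ≠ ∞) : 0 < p.toReal :=
  ENNReal.toReal_pos (zero_lt_one.trans_le (Fact.out : 1 ≤ p)).ne' hp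

/-- A vector dominated by `w ^ (1 / p)` lies in the unit ball. For `p = ∞` the exponent is
`1 / p.toReal = 1 / 0 = 0`. -/
theorem norm_toLp_le_one {w : Fin n → ℝ} {y : Fin n → 𝕜} (hw : ∀ i, 0 ≤ w i)
    (hw1 : ∑ i, w i ≤ 1) (hy : ∀ i, ‖y i‖ ≤ w i ^ (1 / p.toReal)) :
    ‖(WithLp.toLp p y : ellp 𝕜 p n)‖ ≤ 1 := by
  by_cases hp : p = ∞
  · subst hp
    rw [PiLp.norm_eq_ciSup]
    exact Real.iSup_le (fun i => by simpa using hy i) zero_le_one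
  · have hp0 := toReal_pos_of_ne_top hp
    rw [PiLp.norm_eq_sum hp0]
    refine Real.rpow_le_one (Finset.sum_nonneg fun i _ => by positivity) ?_ (by positivity)
    refine (Finset.sum_le_sum fun i _ => ?_).trans hw1
    calc ‖y i‖ ^ p.toReal ≤ (w i ^ (1 / p.toReal)) ^ p.toReal :=
          Real.rpow_le_rpow (norm_nonneg _) (hy i) hp0.le
      _ = w i := by rw [← Real.rpow_mul (hw i), one_div_mul_cancel hp0.ne', Real.rpow_one]

theorem exists_weight_of_norm_le_one {x : ellp 𝕜 p n} (hx : ‖x‖ ≤ 1) :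
    ∃ w : Fin n → ℝ, (∀ i, 0 ≤ w i) ∧ ∑ i, w i ≤ 1 ∧ ∀ i, ‖x i‖ ≤ w i ^ (1 / p.toReal) := by
  by_cases hp : p = ∞
  · subst hp
    exact ⟨0, fun _ => le_rfl, by simp, fun i => by simpa using (PiLp.norm_apply_le x i).trans hx⟩
  · have hp0 := toReal_pos_of_ne_top hp
    refine ⟨fun i => ‖x i‖ ^ p.toReal, fun i => by positivity, ?_, fun i => ?_⟩
    · have h0 : 0 ≤ ∑ i, ‖x i‖ ^ p.toReal := Finset.sum_nonneg fun i _ => by positivity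
      rw [PiLp.norm_eq_sum hp0] at hx
      have := Real.rpow_le_one (by positivity) hx hp0.le
      rwa [← Real.rpow_mul h0, one_div_mul_cancel hp0.ne', Real.rpow_one] at this
    · simp only
      rw [← Real.rpow_mul (norm_nonneg _), mul_one_div_cancel hp0.ne', Real.rpow_one]

theorem toLp_eq_sum_unitVec {q : ℝ≥0∞} (y : Fin n → 𝕜) :
    (WithLp.toLp q y : ellp 𝕜 q n) = ∑ i, y i • unitVec 𝕜 q i := by
  ext i
  simp [unitVec, Pi.single_apply]

/-- The expansion of a multilinear form in terms of its coefficients. -/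
theorem apply_eq_sum_coeff {q : ℝ≥0∞}
    (T : ContinuousMultilinearMap 𝕜 (fun _ : Fin m => ellp 𝕜 q n) 𝕜)
    (y : Fin m → Fin n → 𝕜) : T (fun l => WithLp.toLp q (y l))
      = ∑ j : Fin m → Fin n, T (fun i => unitVec 𝕜 q (j i)) * ∏ l, y l (j l) := by
  simp only [toLp_eq_sum_unitVec]
  rw [T.map_sum]
  refine Finset.sum_congr rfl fun j _ => ?_
  rw [T.map_smul_univ, smul_eq_mul, mul_comm]

theorem formBound_coeff (T : ContinuousMultilinearMap 𝕜 (fun _ : Fin m => ellp 𝕜 p n) 𝕜) :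
    FormBound (fun j : Fin m → Fin n => T fun i => unitVec 𝕜 p (j i)) (1 / p.toReal) ‖T‖ := by
  intro w y hw hw1 hy
  rw [← apply_eq_sum_coeff]
  refine (T.le_opNorm _).trans ?_
  have : ∏ l, ‖(WithLp.toLp p (y l) : ellp 𝕜 p n)‖ ≤ 1 :=
    Finset.prod_le_one (fun _ _ => norm_nonneg _)
      fun l _ => norm_toLp_le_one (hw l) (hw1 l) (hy l)
  exact mul_le_of_le_one_right (norm_nonneg _) this

/-- The multilinear form on `ℓ_p^n` with a given array of coefficients. -/
noncomputable def formOfArray (p : ℝ≥0∞) [Fact (1 ≤ p)] (a : (Fin m → Fin n) → 𝕜) :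
    ContinuousMultilinearMap 𝕜 (fun _ : Fin m => ellp 𝕜 p n) 𝕜 :=
  ∑ j, a j • (ContinuousMultilinearMap.mkPiAlgebra 𝕜 (Fin m) 𝕜).compContinuousLinearMap
    fun l => PiLp.proj p (fun _ : Fin n => 𝕜) (j l)

theorem formOfArray_apply (a : (Fin m → Fin n) → 𝕜) (x : Fin m → ellp 𝕜 p n) :
    formOfArray p a x = ∑ j, a j * ∏ l, x l (j l) := by
  simp [formOfArray]

theorem formOfArray_unitVec (a : (Fin m → Fin n) → 𝕜) (j : Fin m → Fin n) :
    formOfArray p a (fun i => unitVec 𝕜 p (j i)) = a j := by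
  rw [formOfArray_apply, Finset.sum_eq_single j]
  · simp [unitVec]
  · intro j' _ hne
    obtain ⟨l, hl⟩ := Function.ne_iff.1 hne
    rw [Finset.prod_eq_zero (Finset.mem_univ l), mul_zero]
    simp [unitVec, hl]
  · simp

theorem norm_formOfArray_le {a : (Fin m → Fin n) → 𝕜} {B : ℝ}
    (h : FormBound a (1 / p.toReal) B) : ‖formOfArray p a‖ ≤ B := by
  refine ContinuousMultilinearMap.opNorm_le_bound h.nonneg fun x => ?_
  have hx : x = fun l => (‖x l‖ : 𝕜) • ((‖x l‖⁻¹ : ℝ) : 𝕜) • x l := by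
    funext l
    rcases eq_or_ne (x l) 0 with h0 | h0
    · simp [h0]
    · rw [smul_smul, ← RCLike.ofReal_mul, mul_inv_cancel₀ (norm_ne_zero_iff.2 h0),
        RCLike.ofReal_one, one_smul]
  have h1 : ‖formOfArray p a fun l => ((‖x l‖⁻¹ : ℝ) : 𝕜) • x l‖ ≤ B := by
    have hle : ∀ l, ‖((‖x l‖⁻¹ : ℝ) : 𝕜) • x l‖ ≤ 1 := fun l => by
      rw [norm_smul, RCLike.norm_ofReal, abs_of_nonneg (by positivity)]
      exact inv_mul_le_one
    choose w hw hw1 hy using fun l => exists_weight_of_norm_le_one (hle l)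
    rw [formOfArray_apply]
    exact h w _ hw hw1 hy
  have h2 : formOfArray p a x
      = (∏ l, (‖x l‖ : 𝕜)) • formOfArray p a fun l => ((‖x l‖⁻¹ : ℝ) : 𝕜) • x l := by
    -- `x` also occurs inside the right-hand side of `hx`
    conv_lhs => rw [hx]
    exact ContinuousMultilinearMap.map_smul_univ _ _ _
  rw [h2, norm_smul, norm_prod, mul_comm]
  simp only [RCLike.norm_ofReal, abs_norm]
  exact mul_le_mul_of_nonneg_right h1 (Finset.prod_nonneg fun _ _ => norm_nonneg _)

/-- The inequality of `HLInequality`, tested on an array. -/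
theorem HLInequality.sum_rpow_le {r D s B : ℝ} (H : HLInequality 𝕜 m r p D s) (hD : 0 < D)
    (hn : 0 < n) {a : (Fin m → Fin n) → 𝕜} (h : FormBound a (1 / p.toReal) B) :
    (∑ j, ‖a j‖ ^ r) ^ (1 / r) ≤ D * (n : ℝ) ^ s * B := by
  have h1 := H n hn (formOfArray p a)
  simp only [coeffSum, formOfArray_unitVec] at h1
  exact h1.trans (mul_le_mul_of_nonneg_left (norm_formOfArray_le h) (by positivity))

/-! ### Optimality of the exponents -/

/-- Comparison of the growth of two powers of `n`. -/
theorem le_of_forall_rpow_le {e s C : ℝ} {n₀ : ℕ}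
    (h : ∀ n : ℕ, n₀ ≤ n → (n : ℝ) ^ e ≤ C * (n : ℝ) ^ s) : e ≤ s := by
  by_contra! hlt
  have htend : Filter.Tendsto (fun n : ℕ => (n : ℝ) ^ (e - s)) Filter.atTop Filter.atTop :=
    (tendsto_rpow_atTop (sub_pos.2 hlt)).comp tendsto_natCast_atTop_atTop
  obtain ⟨n, hn1, hn2, hn3⟩ := ((htend.eventually_gt_atTop C).and
    ((Filter.eventually_ge_atTop n₀).and (Filter.eventually_ge_atTop 1))).exists
  have hn : (0 : ℝ) < n := by exact_mod_cast hn3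
  have h2 := h n hn2
  rw [Real.rpow_sub hn, lt_div_iff₀ (by positivity)] at hn1
  linarith

theorem HLInequality.exponent_nonneg {r D s : ℝ} (H : HLInequality 𝕜 m r p D s) (hD : 0 < D)
    (hr : 0 < r) : 0 ≤ s := by
  refine le_of_forall_rpow_le (C := D) (n₀ := 1) fun n hn => ?_
  have h := H.sum_rpow_le hD hn
    (formBound_single (𝕜 := 𝕜) (fun _ : Fin m => (⟨0, hn⟩ : Fin n)) (t := 1 / p.toReal)
      (by positivity))
  rw [Finset.sum_eq_single (fun _ : Fin m => (⟨0, hn⟩ : Fin n))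
    (fun j _ hj => by simp [hj, hr.ne']) (by simp)] at h
  simpa using h

/-- The diagonal form gives the optimality of the exponent for `m < p ≤ 2m`. -/
theorem HLInequality.exponent_ge_diagonal {r D s : ℝ} (H : HLInequality 𝕜 m r p D s) (hD : 0 < D)
    (hr : 0 < r) (hm : 0 < m) (hp : 1 / p.toReal ≤ 1 / m) :
    1 / r + m * (1 / p.toReal) - 1 ≤ s := by
  have hm' : (0 : ℝ) < m := by exact_mod_cast hm
  suffices h : 1 / r ≤ s + (1 - m * (1 / p.toReal)) by linarith
  refine le_of_forall_rpow_le (C := D) (n₀ := 1) fun n hn => ?_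
  have hn' : (0 : ℝ) < n := by exact_mod_cast hn
  have h := H.sum_rpow_le hD hn ((formBound_diagonal (𝕜 := 𝕜) hm).mono_exponent hn
    (by positivity) hp)
  rw [sum_norm_diagonal_rpow hm hr, mul_sub, mul_one_div_cancel hm'.ne', mul_one, mul_assoc,
    ← Real.rpow_add hn'] at h
  exact h

/-- Random signs give the optimality of the exponent for `p ≥ 2`. The logarithmic factor of
`exists_sign_formBound` is absorbed by an arbitrarily small power of `n`. -/
theorem HLInequality.exponent_ge_random {r D s : ℝ} (H : HLInequality 𝕜 m r p D s) (hD : 0 < D)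
    (hm : 0 < m) (hp : 1 / p.toReal ≤ 1 / 2) :
    m * (1 / r + 1 / p.toReal - 1 / 2) - 1 / 2 ≤ s := by
  refine le_of_forall_pos_le_add fun η hη => ?_
  suffices h : m / r ≤ s + (m * (1 / 2 - 1 / p.toReal) + (1 / 2 + η)) by
    have : (m : ℝ) * (1 / r + 1 / p.toReal - 1 / 2) - 1 / 2
      = m / r - (m * (1 / 2 - 1 / p.toReal) + 1 / 2) := by ring
    linarith
  refine le_of_forall_rpow_le (n₀ := 16)
    (C := D * (4 ^ m * (2 * √(m * (3 ^ (2 * η) / (2 * η)))))) fun n hn => ?_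
  have hn0 : 0 < n := by omega
  have hn' : (0 : ℝ) < n := by exact_mod_cast hn0
  have hn1 : (1 : ℝ) ≤ n := by exact_mod_cast hn0
  obtain ⟨ε, hε⟩ := exists_sign_formBound (𝕜 := 𝕜) hm hn
  have h := H.sum_rpow_le hD hn0 (hε.mono_exponent hn0 (by positivity) hp)
  simp only [norm_boolSign, Real.one_rpow, Finset.sum_const, Finset.card_univ, Fintype.card_fun,
    Fintype.card_fin, nsmul_eq_mul, mul_one] at h
  push_cast at h
  rw [← Real.rpow_natCast, ← Real.rpow_mul hn'.le, mul_one_div] at h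
  refine h.trans ?_
  have hlog : Real.log (2 * n + 1) ≤ (3 ^ (2 * η) / (2 * η)) * (n : ℝ) ^ (2 * η) := by
    refine (Real.log_le_rpow_div (by positivity) (by positivity : 0 < 2 * η)).trans ?_
    rw [div_mul_eq_mul_div, ← Real.mul_rpow (by norm_num) hn'.le]
    gcongr
    linarith
  have hsqrt : √(n * m * Real.log (2 * n + 1))
      ≤ √(m * (3 ^ (2 * η) / (2 * η))) * (n : ℝ) ^ (1 / 2 + η) := by
    rw [Real.sqrt_le_left (by positivity), mul_pow, Real.sq_sqrt (by positivity),
      ← Real.rpow_mul_natCast hn'.le]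
    have e : (n : ℝ) ^ ((1 / 2 + η) * (2 : ℕ)) = n * (n : ℝ) ^ (2 * η) := by
      rw [← Real.rpow_one_add' hn'.le (by positivity)]
      congr 1
      push_cast
      ring
    rw [e]
    calc n * m * Real.log (2 * n + 1)
        ≤ n * m * ((3 ^ (2 * η) / (2 * η)) * (n : ℝ) ^ (2 * η)) := by gcongr
      _ = _ := by ring
  rw [Real.rpow_add hn', Real.rpow_add hn' (m * (1 / 2 - 1 / p.toReal))]
  calc D * (n : ℝ) ^ s * ((n : ℝ) ^ (m * (1 / 2 - 1 / p.toReal))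
        * (4 ^ m * (2 * √(n * m * Real.log (2 * n + 1)))))
      ≤ D * (n : ℝ) ^ s * ((n : ℝ) ^ (m * (1 / 2 - 1 / p.toReal))
        * (4 ^ m * (2 * (√(m * (3 ^ (2 * η) / (2 * η))) * (n : ℝ) ^ (1 / 2 + η))))) := by
        gcongr
    _ = _ := by ring

theorem expA_eq {r : ℝ} (hr : 0 < r) :
    expA m r p = m * (1 / r + 1 / p.toReal - 1 / 2) - 1 / 2 := by
  unfold expA
  split_ifs with hp
  · subst hp
    simp only [ENNReal.toReal_top, div_zero]
    field_simp
    ring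
  · have := toReal_pos_of_ne_top hp
    field_simp
    ring

theorem expB_eq {r : ℝ} (hr : 0 < r) (hp : p ≠ ∞) :
    expB m r p = 1 / r + m * (1 / p.toReal) - 1 := by
  have := toReal_pos_of_ne_top hp
  unfold expB
  field_simp

end

theorem theorem1 (𝕜 : Type*) [RCLike 𝕜] (m : ℕ) (hm : 2 ≤ m) (r : ℝ) (p : ℝ≥0∞)
    [Fact (1 ≤ p)] :
    (((1 ≤ r ∧ r ≤ 2) ∧ (2 ≤ p ∧ p < 2 * (m : ℝ≥0∞))) ∨ (1 ≤ r ∧ 2 * (m : ℝ≥0∞) ≤ p) →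
      (∃ D : ℝ, 0 < D ∧ HLInequality 𝕜 m r p D (max (expA m r p) 0)) ∧
      (∀ s : ℝ, (∃ D : ℝ, 0 < D ∧ HLInequality 𝕜 m r p D s) → max (expA m r p) 0 ≤ s)) ∧
    (2 ≤ r ∧ (m : ℝ≥0∞) < p ∧ p ≤ 2 * (m : ℝ≥0∞) →
      HLInequality 𝕜 m r p (Real.sqrt 2 ^ (m - 1)) (max (expB m r p) 0) ∧
      (∀ s : ℝ, (∃ D : ℝ, 0 < D ∧ HLInequality 𝕜 m r p D s) → max (expB m r p) 0 ≤ s)) := by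
  obtain ⟨d, rfl⟩ : ∃ d, m = d + 1 := ⟨m - 1, by omega⟩
  have hd : (0 : ℝ) < d + 1 := by positivity
  have hcast : (2 * ((d + 1 : ℕ) : ℝ≥0∞)).toReal = 2 * ((d : ℝ) + 1) := by
    rw [ENNReal.toReal_mul, ENNReal.toReal_natCast]
    push_cast
    rfl
  have hfin : (2 * ((d + 1 : ℕ) : ℝ≥0∞)) ≠ ∞ := ENNReal.mul_ne_top (by simp) (by simp)
  -- `1 / p.toReal = 0` for `p = ∞`, so that bounds from above hold in that case as well
  have hinv_le : ∀ q : ℝ≥0∞, 0 < q.toReal → q ≤ p → 1 / p.toReal ≤ 1 / q.toReal := by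
    intro q hq hqp
    by_cases hp : p = ∞
    · simp [hp]
    · exact one_div_le_one_div_of_le hq (ENNReal.toReal_mono hp hqp)
  have hinv_ge : p ≤ 2 * ((d + 1 : ℕ) : ℝ≥0∞) → 1 / (2 * ((d : ℝ) + 1)) ≤ 1 / p.toReal :=
    fun h => one_div_le_one_div_of_le (toReal_pos_of_ne_top (ne_top_of_le_ne_top hfin h))
      (hcast ▸ ENNReal.toReal_mono hfin h)
  have ht0 : 0 ≤ 1 / p.toReal := by positivity
  constructor
  · intro h
    have hr1 : 1 ≤ r := h.elim (fun h => h.1.1) fun h => h.1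
    have hr : 0 < r := by linarith
    have hp2 : 2 ≤ p := by
      refine h.elim (fun h => h.2.1) fun h => le_trans ?_ h.2
      calc (2 : ℝ≥0∞) = 2 * 1 := (mul_one _).symm
        _ ≤ _ := by gcongr; exact_mod_cast Nat.succ_pos d
    rw [expA_eq hr]
    refine ⟨⟨√2 ^ d, by positivity, fun n hn T => ?_⟩, fun s ⟨D, hD, H⟩ => max_le ?_ ?_⟩
    · have hT := formBound_coeff T
      unfold coeffSum
      rcases h with ⟨⟨_, hr2⟩, _, hp⟩ | ⟨_, hp⟩
      · have := hT.rpow_sum_le_max_of_le_two hn hr hr2 (hinv_ge hp.le)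
        exact_mod_cast this
      · have hle := hinv_le _ (by rw [hcast]; positivity) hp
        rw [hcast] at hle
        have := hT.rpow_sum_le_max hn hr ht0 hle
        exact_mod_cast this
    · exact H.exponent_ge_random hD d.succ_pos (by simpa using hinv_le 2 (by simp) hp2)
    · exact H.exponent_nonneg hD hr
  · rintro ⟨hr2, hmp, hp⟩
    have hr : 0 < r := by linarith
    have hptop : p ≠ ∞ := ne_top_of_le_ne_top hfin hp
    have hp0 := toReal_pos_of_ne_top hptop
    have hlt : ((d : ℝ) + 1) < p.toReal := by
      have := (ENNReal.toReal_lt_toReal (by simp) hptop).2 hmp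
      rw [ENNReal.toReal_natCast] at this
      exact_mod_cast this
    rw [expB_eq hr hptop]
    refine ⟨fun n hn T => ?_, fun s ⟨D, hD, H⟩ => max_le ?_ ?_⟩
    · have := (formBound_coeff T).rpow_sum_le_max_of_two_le hn hr2 (hinv_ge hp)
        (by rw [mul_one_div, div_lt_one hp0]; exact hlt)
      unfold coeffSum
      rw [Nat.add_sub_cancel]
      exact_mod_cast this
    · refine H.exponent_ge_diagonal hD hr d.succ_pos (one_div_le_one_div_of_le (by positivity) ?_)
      push_cast
      exact hlt.le
    · exact H.exponent_nonneg hD hr
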